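/- Let $2<\tau<3$ and $h_{\min}>0$. For $n\ge 1$ consider the hidden-variable random graph on $n$ vertices: the hidden variables $h_1,\dots,h_n$ are i.i.d. with density $C h^{-\tau}$ on $[h_{\min},\infty)$ ($C$ the normalising constant) and mean $\mu$, and, conditionally on them, each pair $\{i,j\}$ of distinct vertices is joined independently with probability $\min\bigl(h_ih_j/(\mu n),1\bigr)$. For a fixed graph $H$ let $N(H)$ be the number of labelled, not necessarily induced copies of $H$, i.e. the number of injective maps from the vertices of $H$ to the vertices of the random graph that send edges to edges. Let $\triangle$ be the number of triangles (sets of three pairwise adjacent vertices), so that $N(K_3)=6\triangle$. Let the bow-tie be two triangles sharing exactly one vertex and the diamond two triangles sharing exactly one edge. Then, as $n\to\infty$ with $\tau$ and $h_{\min}$ fixed, $$\operatorname{Var}(N(K_3))=9\,\mathbb E[N(\text{bow-tie})]+18\,\mathbb E[N(\text{diamond})]+6\,\mathbb E[N(K_3)]+O(n^{-1})\,\mathbb E[N(K_3)]^2 .$$ Moreover, $$\frac{\operatorname{Var}(\triangle)}{\mathbb E[\triangle]^2}=\begin{cases}\Theta\bigl(n^{(\tau-3)/2}\bigr), & \tau<7/3,\\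 \Theta\bigl(n^{2\tau-5}\log n\bigr)=\Theta\bigl(n^{-1/3}\log n\bigr), & \tau=7/3,\\ \Theta\bigl(n^{2\tau-5}\bigr), & \tau>7/3.\end{cases}$$ Consequently $$\lim_{n\to\infty}\frac{\operatorname{Var}(\triangle)}{\mathbb E[\triangle]^2}=\begin{cases}0,&\tau<5/2,\\ \infty,&\tau>5/2,\end{cases}$$ and the ratio is $\Theta(1)$ for $\tau=5/2$. In particular the number of triangles is self-averaging (the ratio tends to $0$) if and only if $\tau<5/2$. -/

import Mathlib

open MeasureTheory ProbabilityTheory Filter Asymptotics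
open scoped Topology

namespace HiddenVariable

/-- The law of one hidden variable: the probability measure on `ℝ` with density `C * h ^ (-τ)` for
`h ≥ hmin`, where the normalisation forces `C = (τ - 1) * hmin ^ (τ - 1)`. This is the Pareto law
with scale `hmin` and shape `τ - 1`. -/
noncomputable def weightLaw (τ hmin : ℝ) : Measure ℝ := paretoMeasure hmin (τ - 1)

/-- The mean `μ` of a hidden variable. -/
noncomputable def meanWeight (τ hmin : ℝ) : ℝ := ∫ h, h ∂(weightLaw τ hmin)

/-- The connection probability `p(h, h') = min (h h' / (μ n)) 1`. -/
noncomputable def connProb (τ hmin : ℝ) (n : ℕ) (h h' : ℝ) : ℝ :=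
  min (h * h' / (meanWeight τ hmin * n)) 1

/-- The sample space of the model on `n` vertices: a hidden variable for every vertex and a
label for every unordered pair of vertices (labels of diagonal pairs are never used). -/
abbrev Sample (n : ℕ) : Type := (Fin n → ℝ) × (Sym2 (Fin n) → ℝ)

/-- The hidden variables are i.i.d. with law `weightLaw`, the labels are i.i.d. uniform on `[0, 1]`,
and the two families are independent. -/
noncomputable def sampleLaw (τ hmin : ℝ) (n : ℕ) : Measure (Sample n) :=
  (Measure.pi fun _ : Fin n => weightLaw τ hmin).prod
    (Measure.pi fun _ : Sym2 (Fin n) => (volume : Measure ℝ).restrict (Set.Icc 0 1))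

/-- The random graph: distinct vertices `i`, `j` are joined when the uniform label of the pair
`{i, j}` is at most `p(h_i, h_j)`. Thus, conditionally on the hidden variables, the pairs are joined
independently, the pair `{i, j}` with probability `p(h_i, h_j)`. -/
noncomputable def randomGraph (τ hmin : ℝ) (n : ℕ) (ω : Sample n) : SimpleGraph (Fin n) where
  Adj i j := i ≠ j ∧ ω.2 s(i, j) ≤ connProb τ hmin n (ω.1 i) (ω.1 j)
  symm := ⟨fun i j h => by
    refine ⟨h.1.symm, ?_⟩
    have h2 := h.2
    rw [Sym2.eq_swap]
    simpa only [connProb, mul_comm (ω.1 j) (ω.1 i)] using h2⟩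
  loopless := ⟨fun _ h => h.1 rfl⟩

/-- The expectation of a graph statistic in the hidden-variable model on `n` vertices. -/
noncomputable def expect (τ hmin : ℝ) (n : ℕ) (X : SimpleGraph (Fin n) → ℝ) : ℝ :=
  ∫ ω, X (randomGraph τ hmin n ω) ∂(sampleLaw τ hmin n)

/-- The variance of a graph statistic in the hidden-variable model on `n` vertices. -/
noncomputable def var (τ hmin : ℝ) (n : ℕ) (X : SimpleGraph (Fin n) → ℝ) : ℝ :=
  variance (fun ω => X (randomGraph τ hmin n ω)) (sampleLaw τ hmin n)

/-- The triangle. -/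
def triangle : SimpleGraph (Fin 3) := ⊤

/-- The bow-tie: two triangles sharing exactly the vertex `0`. -/
def bowTie : SimpleGraph (Fin 5) :=
  SimpleGraph.fromEdgeSet {s(0, 1), s(0, 2), s(1, 2), s(0, 3), s(0, 4), s(3, 4)}

/-- The diamond: two triangles sharing exactly the edge `{0, 1}`. -/
def diamond : SimpleGraph (Fin 4) :=
  SimpleGraph.fromEdgeSet {s(0, 1), s(0, 2), s(1, 2), s(0, 3), s(1, 3)}

/-- The motif count `N(H)`: the number of labelled, not necessarily induced copies of `H` in `G`,
that is, of injective maps from the vertices of `H` to those of `G` sending edges to edges. -/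
noncomputable def motifCount {k n : ℕ} (H : SimpleGraph (Fin k)) (G : SimpleGraph (Fin n)) : ℝ :=
  (G.labelledCopyCount H : ℝ)

/-- The number `△` of triangles of `G`: sets of three pairwise adjacent vertices. -/
noncomputable def triangleCount {n : ℕ} (G : SimpleGraph (Fin n)) : ℝ :=
  ((G.cliqueSet 3).ncard : ℝ)

/-- The relative fluctuation `Var(△) / E[△]²` in the model on `n` vertices. -/
noncomputable def relFluct (τ hmin : ℝ) (n : ℕ) : ℝ :=
  var τ hmin n triangleCount / expect τ hmin n triangleCount ^ 2

end HiddenVariable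

/-! The variance is a second-moment computation. Expand `triangleCount ^ 2` over ordered pairs of
3-sets and sort them by the size of their intersection. Disjoint pairs contribute the square `t ^ 2`
of the triangle density `t`; overlaps of size 1, 2, 3 give the bow-tie, the diamond and the
triangle. Since the falling factorials satisfy (n)₃² = (n)₆ + 9(n)₅ + 18(n)₄ + 6(n)₃, subtracting
the squared mean leaves an exact identity (`var_motifCount_triangle`). Its defect has order n⁵t²,
which is n⁻¹ times the squared mean.

For the orders of magnitude put N = μn and let T(x) be the probability that a vertex of weight x and
two further vertices form a triangle (`kernelTriangle`). Then t = ∫T, and the bow-tie density is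
∫T², because its two triangles are conditionally independent given the weight of the common vertex.
The triangle density comes from weights near √N and has order N^(-3(τ-1)/2). For √N ≤ x ≤ N/hmin,
T(x) has order N^(3-2τ) x^(2τ-4): the upper bound (`kernelTriangle_le`) decouples the two other
vertices by min(a,1) ≤ a^s, the lower bound (`le_kernelTriangle`) takes both of them above N/x.

Hence ∫T² is governed by the integral of x^(3τ-8) from √N to a multiple of N. The lower end
dominates for τ < 7/3, every scale counts equally at τ = 7/3, which produces the logarithm, and for
τ > 7/3 the hubs of weight of order N dominate. Relative to the squared mean, the diamond is
O(n^((τ-3)/2)) by `integral_diamond_le`, and the triangle term and the defect are no larger, so the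
bow-tie decides the order (`isTheta_relFluct`). The threshold 5/2 is the zero of the exponent 2τ-5.
-/

namespace HiddenVariable

/-! ### Triangle counts and overlapping pairs of triangles -/

section Combinatorics

open Finset

/-- The edges of the triangle. -/
def triangleEdges : Finset (Sym2 (Fin 3)) := {s(0, 1), s(0, 2), s(1, 2)}

/-- The edges of the bow-tie. -/
def bowTieEdges : Finset (Sym2 (Fin 5)) := {s(0, 1), s(0, 2), s(1, 2), s(0, 3), s(0, 4), s(3, 4)}

/-- The edges of the diamond. -/
def diamondEdges : Finset (Sym2 (Fin 4)) := {s(0, 1), s(0, 2), s(1, 2), s(0, 3), s(1, 3)}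

/-- The edges of two disjoint triangles. -/
def twoTriangleEdges : Finset (Sym2 (Fin 6)) :=
  {s(0, 1), s(0, 2), s(1, 2), s(3, 4), s(3, 5), s(4, 5)}

open Classical in
/-- The indicator of the event that the unordered pair `e` is an edge of `G`. -/
noncomputable def edgeInd {n : ℕ} (G : SimpleGraph (Fin n)) (e : Sym2 (Fin n)) : ℝ :=
  if e ∈ G.edgeSet then 1 else 0

/-- The indicator of the event that `f` maps all the pairs in `E` to edges of `G`. -/
noncomputable def patternInd {k n : ℕ} (E : Finset (Sym2 (Fin k))) (f : Fin k → Fin n)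
    (G : SimpleGraph (Fin n)) : ℝ :=
  ∏ e ∈ E, edgeInd G (e.map f)

open Classical in
/-- The indicator of the event that `s` is a clique of `G`. -/
noncomputable def cliqueInd {n : ℕ} (s : Finset (Fin n)) (G : SimpleGraph (Fin n)) : ℝ :=
  if G.IsClique (s : Set (Fin n)) then 1 else 0

lemma edgeInd_mul_self {n : ℕ} (G : SimpleGraph (Fin n)) (e : Sym2 (Fin n)) :
    edgeInd G e * edgeInd G e = edgeInd G e := by
  unfold edgeInd; split_ifs <;> simp

open Classical in
lemma patternInd_eq_ite {k n : ℕ} (E : Finset (Sym2 (Fin k))) (f : Fin k → Fin n)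
    (G : SimpleGraph (Fin n)) :
    patternInd E f G = if ∀ e ∈ E, e.map f ∈ G.edgeSet then 1 else 0 := by
  simp only [patternInd, edgeInd, Finset.prod_ite_zero, Finset.prod_const_one]

/-- A copy is the same datum as an embedding respecting the pairs in `E`; `fromEdgeSet` discards
diagonal pairs, so `hE` is what makes the two edge conditions agree. -/
lemma motifCount_fromEdgeSet {k n : ℕ} (E : Finset (Sym2 (Fin k)))
    (G : SimpleGraph (Fin n)) (hE : ∀ e ∈ E, ¬ e.IsDiag) :
    motifCount (SimpleGraph.fromEdgeSet (E : Set (Sym2 (Fin k)))) G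
      = ∑ f : Fin k ↪ Fin n, patternInd E f G := by
  classical
  have key : SimpleGraph.Copy (SimpleGraph.fromEdgeSet (E : Set (Sym2 (Fin k)))) G ≃
      {f : Fin k ↪ Fin n // ∀ e ∈ E, e.map f ∈ G.edgeSet} :=
    { toFun := fun c => ⟨⟨c.toHom, c.injective'⟩, fun e he => by
        induction e with
        | _ a b =>
          have hab : a ≠ b := fun h => hE _ he (by simpa using h)
          have : (SimpleGraph.fromEdgeSet (E : Set (Sym2 (Fin k)))).Adj a b := by
            simpa [SimpleGraph.fromEdgeSet_adj] using ⟨he, hab⟩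
          simpa using c.toHom.map_adj this⟩
      invFun := fun f => ⟨⟨f.1, fun {a b} hab => by
        have := f.2 s(a, b) (by simpa using ((SimpleGraph.fromEdgeSet_adj _).1 hab).1)
        simpa using this⟩, f.1.injective⟩
      left_inv := fun c => rfl
      right_inv := fun f => rfl }
  have : motifCount (SimpleGraph.fromEdgeSet (E : Set (Sym2 (Fin k)))) G
      = (Fintype.card {f : Fin k ↪ Fin n // ∀ e ∈ E, e.map f ∈ G.edgeSet} : ℝ) := by
    rw [motifCount, SimpleGraph.labelledCopyCount, ← Fintype.card_congr key]
    congr!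
  rw [this, Fintype.card_subtype]
  simp [patternInd_eq_ite]

lemma triangle_eq : triangle = SimpleGraph.fromEdgeSet (triangleEdges : Set (Sym2 (Fin 3))) := by
  ext a b
  rw [SimpleGraph.fromEdgeSet_adj, triangle, SimpleGraph.top_adj, Finset.mem_coe, triangleEdges]
  revert a b
  decide

lemma bowTie_eq : bowTie = SimpleGraph.fromEdgeSet (bowTieEdges : Set (Sym2 (Fin 5))) := by
  simp [bowTie, bowTieEdges]

lemma diamond_eq : diamond = SimpleGraph.fromEdgeSet (diamondEdges : Set (Sym2 (Fin 4))) := by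
  simp [diamond, diamondEdges]

lemma triangleCount_eq_sum {n : ℕ} (G : SimpleGraph (Fin n)) :
    triangleCount G = ∑ s ∈ powersetCard 3 univ, cliqueInd s G := by
  classical
  rw [triangleCount]
  have : G.cliqueSet 3 = (((powersetCard 3 univ).filter
      fun s : Finset (Fin n) => G.IsClique (s : Set (Fin n)) : Finset (Finset (Fin n))) :
      Set (Finset (Fin n))) := by
    ext s
    simp [SimpleGraph.mem_cliqueSet_iff, SimpleGraph.isNClique_iff, and_comm]
  rw [this, Set.ncard_coe_finset, Finset.card_filter]
  push_cast
  rfl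

lemma cliqueInd_triple {n : ℕ} {a b c : Fin n} (hab : a ≠ b) (hac : a ≠ c) (hbc : b ≠ c)
    (G : SimpleGraph (Fin n)) :
    cliqueInd {a, b, c} G = edgeInd G s(a, b) * edgeInd G s(a, c) * edgeInd G s(b, c) := by
  classical
  have : G.IsClique (({a, b, c} : Finset (Fin n)) : Set (Fin n)) ↔
      G.Adj a b ∧ G.Adj a c ∧ G.Adj b c := by
    simp only [coe_insert, coe_singleton]
    rw [SimpleGraph.isClique_insert_of_notMem (by simp [hab, hac]),
      SimpleGraph.isClique_insert_of_notMem (by simpa using hbc)]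
    simp
    tauto
  simp only [cliqueInd, edgeInd, this, SimpleGraph.mem_edgeSet]
  by_cases h1 : G.Adj a b <;> by_cases h2 : G.Adj a c <;> by_cases h3 : G.Adj b c <;>
    simp [h1, h2, h3]

lemma cliqueInd_map {n : ℕ} (f : Fin 3 ↪ Fin n) (G : SimpleGraph (Fin n)) :
    cliqueInd (univ.map f) G = patternInd triangleEdges f G := by
  have h : (univ.map f : Finset (Fin n)) = {f 0, f 1, f 2} := by
    ext x; simp [Fin.exists_fin_succ, eq_comm]
  rw [h, cliqueInd_triple (f.injective.ne (by decide)) (f.injective.ne (by decide))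
    (f.injective.ne (by decide)), patternInd, triangleEdges, prod_insert (by decide),
    prod_insert (by decide), prod_singleton]
  simp [mul_assoc]

/-- Labelled triangles are counted six times. -/
lemma motifCount_triangle {n : ℕ} (G : SimpleGraph (Fin n)) :
    motifCount triangle G = 6 * triangleCount G := by
  classical
  rw [triangle_eq, motifCount_fromEdgeSet _ _ (by decide), triangleCount_eq_sum, mul_sum]
  have hmaps : ∀ f ∈ (univ : Finset (Fin 3 ↪ Fin n)),
      univ.map f ∈ powersetCard 3 (univ : Finset (Fin n)) := by
    intro f _; simp [mem_powersetCard]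
  -- Group the embeddings by their image; those with image `s` are the 3! bijections from `Fin 3`
  -- onto `s`.
  rw [← sum_fiberwise_of_maps_to hmaps]
  refine sum_congr rfl fun s hs => ?_
  rw [sum_congr rfl (g := fun _ => cliqueInd s G), sum_const, nsmul_eq_mul]
  · congr 1
    have hs3 : s.card = 3 := (mem_powersetCard.1 hs).2
    have e : {f : Fin 3 ↪ Fin n // univ.map f = s} ≃ (Fin 3 ≃ s) :=
      { toFun := fun f => Equiv.ofBijective
          (fun i => ⟨f.1 i, f.2.subset (mem_map_of_mem _ (mem_univ i))⟩)
          ((Fintype.bijective_iff_injective_and_card _).2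
            ⟨fun i j h => f.1.injective (by simpa using h), by simp [hs3]⟩)
        invFun := fun g => ⟨⟨fun i => g i, fun i j h => g.injective (Subtype.ext h)⟩, by
          refine eq_of_subset_of_card_le (fun x hx => ?_) (by simp [hs3])
          obtain ⟨i, -, rfl⟩ := mem_map.1 hx
          exact (g i).2⟩
        left_inv := fun f => by ext; rfl
        right_inv := fun g => by ext; rfl }
    rw [← Fintype.card_subtype, Fintype.card_congr e,
      Fintype.card_equiv (Fintype.equivOfCardEq (by simp [hs3]))]
    simp [Nat.factorial]
  · intro f hf
    rw [← (mem_filter.1 hf).2, cliqueInd_map]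

/-- A set `t` is determined by its parts inside and outside `s`, which can be chosen independently.
-/
lemma card_filter_card_inter {n : ℕ} {s : Finset (Fin n)} (hs : s.card = 3) {k : ℕ} (hk : k ≤ 3) :
    ((powersetCard 3 univ).filter fun t => (s ∩ t).card = k).card
      = Nat.choose 3 k * Nat.choose (n - 3) (3 - k) := by
  classical
  have hc : sᶜ.card = n - 3 := by rw [card_compl, hs, Fintype.card_fin]
  have hp : Nat.choose 3 k * Nat.choose (n - 3) (3 - k)
      = (powersetCard k s ×ˢ powersetCard (3 - k) sᶜ).card := by
    rw [card_product, card_powersetCard, card_powersetCard, hs, hc]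
  rw [hp]
  refine card_nbij' (fun t => (s ∩ t, sᶜ ∩ t)) (fun p => p.1 ∪ p.2) ?_ ?_ ?_ ?_
  · intro t ht
    simp only [coe_filter, mem_powersetCard, Set.mem_ofPred_eq, subset_univ, true_and] at ht
    simp only [coe_product, Set.mem_prod, mem_coe, mem_powersetCard, inter_subset_left, true_and]
    refine ⟨ht.2, ?_⟩
    have := card_inter_add_card_sdiff t s
    have h2 : sᶜ ∩ t = t \ s := by ext; simp [and_comm]
    rw [h2]; rw [inter_comm] at this; omega
  · rintro ⟨a, b⟩ h
    simp only [coe_product, Set.mem_prod, mem_coe, mem_powersetCard] at h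
    obtain ⟨⟨ha, hak⟩, hb, hbk⟩ := h
    have hd : Disjoint a b := disjoint_of_subset_left ha
      (disjoint_of_subset_right hb disjoint_compl_right)
    simp only [coe_filter, mem_powersetCard, Set.mem_ofPred_eq, subset_univ, true_and]
    refine ⟨by rw [card_union_of_disjoint hd]; omega, ?_⟩
    have h1 : s ∩ (a ∪ b) = a := by
      ext x
      have h1 := @ha x
      have h2 := @hb x
      simp at h2 ⊢; tauto
    rw [h1, hak]
  · intro t _
    ext x; simp; tauto
  · rintro ⟨a, b⟩ h
    simp only [coe_product, Set.mem_prod, mem_coe, mem_powersetCard] at h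
    obtain ⟨⟨ha, hak⟩, hb, hbk⟩ := h
    ext x <;>
    · have h1 := @ha x
      have h2 := @hb x
      simp at h2 ⊢; tauto

lemma cliqueInd_eq_patternInd {n : ℕ} {s : Finset (Fin n)} (hs : s.card = 3) :
    ∃ f : Fin 3 ↪ Fin n, ∀ G, cliqueInd s G = patternInd triangleEdges f G := by
  obtain ⟨e⟩ : Nonempty (Fin 3 ≃ s) := ⟨Fintype.equivOfCardEq (by simp [hs])⟩
  refine ⟨e.toEmbedding.trans (Function.Embedding.subtype _), fun G => ?_⟩
  rw [← cliqueInd_map]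
  congr 1
  symm
  refine eq_of_subset_of_card_le (fun x hx => ?_) (by simp [hs])
  obtain ⟨i, -, rfl⟩ := mem_map.1 hx
  exact (e i).2

/-- This lemma and the next two rewrite a product of clique indicators as the indicator of one
embedded pattern, whose expectation depends only on the pattern. -/
lemma cliqueInd_mul_of_card_inter_zero {n : ℕ} {s t : Finset (Fin n)} (hs : s.card = 3)
    (ht : t.card = 3) (h : (s ∩ t).card = 0) :
    ∃ f : Fin 6 ↪ Fin n, ∀ G, cliqueInd s G * cliqueInd t G = patternInd twoTriangleEdges f G := by
  obtain ⟨a, b, c, hab, hac, hbc, rfl⟩ := card_eq_three.1 hs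
  obtain ⟨d, e, g, hde, hdg, heg, rfl⟩ := card_eq_three.1 ht
  rw [card_eq_zero, ← disjoint_iff_inter_eq_empty] at h
  simp only [disjoint_insert_left, disjoint_singleton_left, mem_insert, mem_singleton,
    not_or] at h
  obtain ⟨⟨h1, h2, h3⟩, ⟨h4, h5, h6⟩, h7, h8, h9⟩ := h
  have hinj : Function.Injective ![a, b, c, d, e, g] := by
    intro i j hij
    fin_cases i <;> fin_cases j <;> simp_all
  refine ⟨⟨_, hinj⟩, fun G => ?_⟩
  rw [cliqueInd_triple hab hac hbc, cliqueInd_triple hde hdg heg, patternInd, twoTriangleEdges]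
  repeat rw [prod_insert (by decide)]
  rw [prod_singleton]
  simp [mul_assoc]

lemma cliqueInd_mul_of_card_inter_one {n : ℕ} {s t : Finset (Fin n)} (hs : s.card = 3)
    (ht : t.card = 3) (h : (s ∩ t).card = 1) :
    ∃ f : Fin 5 ↪ Fin n, ∀ G, cliqueInd s G * cliqueInd t G = patternInd bowTieEdges f G := by
  obtain ⟨a, ha⟩ := card_eq_one.1 h
  have h1 := card_inter_add_card_sdiff s t
  have h2 := card_inter_add_card_sdiff t s
  rw [inter_comm] at h2
  obtain ⟨b, c, hbc, hbc'⟩ := card_eq_two.1 (show (s \ t).card = 2 by omega)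
  obtain ⟨d, e, hde, hde'⟩ := card_eq_two.1 (show (t \ s).card = 2 by omega)
  have ma : a ∈ s ∩ t := by simp [ha]
  have mb : b ∈ s \ t := by simp [hbc']
  have mc : c ∈ s \ t := by simp [hbc']
  have md : d ∈ t \ s := by simp [hde']
  have me : e ∈ t \ s := by simp [hde']
  rw [mem_inter] at ma
  rw [Finset.mem_sdiff] at mb mc md me
  have es : s = {a, b, c} := by
    rw [← Finset.sdiff_union_inter s t, ha, hbc', union_comm]; rfl
  have et : t = {a, d, e} := by
    rw [← Finset.sdiff_union_inter t s, inter_comm, ha, hde', union_comm]; rfl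
  have ab : a ≠ b := fun h => mb.2 (h ▸ ma.2)
  have ac : a ≠ c := fun h => mc.2 (h ▸ ma.2)
  have ad : a ≠ d := fun h => md.2 (h ▸ ma.1)
  have ae : a ≠ e := fun h => me.2 (h ▸ ma.1)
  have bd : b ≠ d := fun h => md.2 (h ▸ mb.1)
  have be : b ≠ e := fun h => me.2 (h ▸ mb.1)
  have cd : c ≠ d := fun h => md.2 (h ▸ mc.1)
  have ce : c ≠ e := fun h => me.2 (h ▸ mc.1)
  have hinj : Function.Injective ![a, b, c, d, e] := by
    clear hbc' hde' ha ma mb mc md me es et h h1 h2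
    intro i j hij
    fin_cases i <;> fin_cases j <;> simp_all
  refine ⟨⟨_, hinj⟩, fun G => ?_⟩
  rw [es, et, cliqueInd_triple ab ac hbc, cliqueInd_triple ad ae hde, patternInd, bowTieEdges]
  repeat rw [prod_insert (by decide)]
  rw [prod_singleton]
  simp [mul_assoc]

lemma cliqueInd_mul_of_card_inter_two {n : ℕ} {s t : Finset (Fin n)} (hs : s.card = 3)
    (ht : t.card = 3) (h : (s ∩ t).card = 2) :
    ∃ f : Fin 4 ↪ Fin n, ∀ G, cliqueInd s G * cliqueInd t G = patternInd diamondEdges f G := by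
  obtain ⟨a, b, hab, ha⟩ := card_eq_two.1 h
  have h1 := card_inter_add_card_sdiff s t
  have h2 := card_inter_add_card_sdiff t s
  rw [inter_comm] at h2
  obtain ⟨c, hc'⟩ := card_eq_one.1 (show (s \ t).card = 1 by omega)
  obtain ⟨d, hd'⟩ := card_eq_one.1 (show (t \ s).card = 1 by omega)
  have ma : a ∈ s ∩ t := by simp [ha]
  have mb : b ∈ s ∩ t := by simp [ha]
  have mc : c ∈ s \ t := by simp [hc']
  have md : d ∈ t \ s := by simp [hd']
  rw [mem_inter] at ma mb
  rw [Finset.mem_sdiff] at mc md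
  have es : s = {a, b, c} := by
    rw [← Finset.sdiff_union_inter s t, ha, hc', union_comm]; ext; simp
  have et : t = {a, b, d} := by
    rw [← Finset.sdiff_union_inter t s, inter_comm, ha, hd', union_comm]; ext; simp
  have ac : a ≠ c := fun h => mc.2 (h ▸ ma.2)
  have bc : b ≠ c := fun h => mc.2 (h ▸ mb.2)
  have ad : a ≠ d := fun h => md.2 (h ▸ ma.1)
  have bd : b ≠ d := fun h => md.2 (h ▸ mb.1)
  have cd : c ≠ d := fun h => md.2 (h ▸ mc.1)
  have hinj : Function.Injective ![a, b, c, d] := by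
    clear hc' hd' ha ma mb mc md es et h h1 h2
    intro i j hij
    fin_cases i <;> fin_cases j <;> simp_all
  refine ⟨⟨_, hinj⟩, fun G => ?_⟩
  rw [es, et, cliqueInd_triple hab ac bc, cliqueInd_triple hab ad bd, patternInd, diamondEdges]
  repeat rw [prod_insert (by decide)]
  rw [prod_singleton]
  -- The common edge occurs in both triangles but only once in the diamond; idempotence of its
  -- indicator removes the repetition.
  have hm := edgeInd_mul_self G s(a, b)
  simp only [Function.Embedding.coeFn_mk, Sym2.map_mk, Matrix.cons_val]
  linear_combination (edgeInd G s(a, c) * edgeInd G s(b, c) * edgeInd G s(a, d)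
    * edgeInd G s(b, d)) * hm

lemma cliqueInd_mul_self {n : ℕ} (s : Finset (Fin n)) (G : SimpleGraph (Fin n)) :
    cliqueInd s G * cliqueInd s G = cliqueInd s G := by
  unfold cliqueInd; split_ifs <;> simp

end Combinatorics

/-! ### Integrating out the edge labels -/

section Labels

/-- The threshold `c` may be negative at weight vectors outside the support of the law; `max 0`
keeps the formula valid pointwise, with no almost-everywhere argument. -/
lemma integral_Icc_ite_le {c : ℝ} (hc : c ≤ 1) :
    ∫ u in Set.Icc (0 : ℝ) 1, (if u ≤ c then (1 : ℝ) else 0) = max 0 c := by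
  have h1 : (fun u : ℝ => if u ≤ c then (1 : ℝ) else 0)
      = (Set.Iic c).indicator (fun _ => (1 : ℝ)) := by
    ext u; simp [Set.indicator_apply]
  have h2 : Set.Icc (0 : ℝ) 1 ∩ Set.Iic c = Set.Icc 0 c := by
    ext u; simp only [Set.mem_inter_iff, Set.mem_Icc, Set.mem_Iic]
    constructor
    · rintro ⟨⟨a, b⟩, d⟩; exact ⟨a, d⟩
    · rintro ⟨a, d⟩; exact ⟨⟨a, d.trans hc⟩, d⟩
  rw [h1, setIntegral_indicator measurableSet_Iic, h2]
  simp [max_comm]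

lemma integral_labels {ι : Type*} [Fintype ι] [DecidableEq ι] (E : Finset ι) {c : ι → ℝ}
    (hc : ∀ e, c e ≤ 1) :
    ∫ u : ι → ℝ, ∏ e ∈ E, (if u e ≤ c e then (1 : ℝ) else 0)
      ∂(Measure.pi fun _ : ι => (volume : Measure ℝ).restrict (Set.Icc 0 1))
      = ∏ e ∈ E, max 0 (c e) := by
  -- Coordinates outside `E` receive the factor 1, so that the integrand is a full product and the
  -- integral factorises.
  have h1 : ∀ u : ι → ℝ, ∏ e ∈ E, (if u e ≤ c e then (1 : ℝ) else 0)
      = ∏ e, (fun e v => if e ∈ E then (if v ≤ c e then (1 : ℝ) else 0) else 1) e (u e) := by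
    intro u
    simp only [Finset.prod_ite_mem, Finset.univ_inter]
  rw [integral_congr_ae (ae_of_all _ h1), integral_fintype_prod_eq_prod
    (fun e v => if e ∈ E then (if v ≤ c e then (1 : ℝ) else 0) else 1)]
  rw [← Finset.univ_inter E, ← Finset.prod_ite_mem]
  refine Finset.prod_congr rfl fun e _ => ?_
  by_cases he : e ∈ E
  · simp only [he, if_true, integral_Icc_ite_le (hc e), Finset.univ_inter]
  · simp [he]

end Labels

/-! ### Marginals and iterated integrals for product measures -/

section Marginals

variable {P : Measure ℝ} [IsProbabilityMeasure P]

/-- Distinct coordinates of an i.i.d. family are again i.i.d.; injectivity of `f` keeps them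
distinct. -/
lemma map_pi_comp {k n : ℕ} (f : Fin k ↪ Fin n) :
    (Measure.pi fun _ : Fin n => P).map (fun h i => h (f i)) = Measure.pi fun _ : Fin k => P := by
  have h := (iIndepFun_pi (μ := fun _ : Fin n => P) (X := fun _ => id)
    (fun _ => aemeasurable_id)).precomp f.injective
  have h2 := h.map_fun_eq_pi_map (fun i => (measurable_pi_apply (f i)).aemeasurable)
  rw [show (fun h : Fin n → ℝ => fun i => h (f i)) = fun ω i => (fun i ω => ω (f i)) i ω from rfl]
  refine h2.trans ?_
  congr
  ext i : 1
  exact (measurePreserving_eval (fun _ : Fin n => P) (f i)).map_eq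

lemma integral_pi_comp {k n : ℕ} (f : Fin k ↪ Fin n) {F : (Fin k → ℝ) → ℝ} (hF : Measurable F) :
    ∫ h, F (fun i => h (f i)) ∂(Measure.pi fun _ : Fin n => P)
      = ∫ h, F h ∂(Measure.pi fun _ : Fin k => P) := by
  rw [← map_pi_comp f,
    integral_map (measurable_pi_lambda _ fun i => measurable_pi_apply (f i)).aemeasurable hF.aestronglyMeasurable]

lemma integrable_of_mem_Icc {Ω : Type*} [MeasurableSpace Ω] {ν : Measure Ω} [IsFiniteMeasure ν]
    {F : Ω → ℝ} (hF : Measurable F) (hb : ∀ h, F h ∈ Set.Icc (0 : ℝ) 1) : Integrable F ν :=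
  Integrable.of_bound hF.aestronglyMeasurable 1
    (ae_of_all _ fun h => by rw [Real.norm_of_nonneg (hb h).1]; exact (hb h).2)

lemma measurable_integral_right {α : Type*} [MeasurableSpace α] {F : α → ℝ → ℝ}
    (hF : Measurable fun p : α × ℝ => F p.1 p.2) : Measurable fun x => ∫ y, F x y ∂P :=
  (hF.stronglyMeasurable.integral_prod_right (ν := P)).measurable

lemma integral_mem_Icc {Ω : Type*} [MeasurableSpace Ω] {ν : Measure Ω} [IsProbabilityMeasure ν]
    {F : Ω → ℝ} (hb : ∀ h, F h ∈ Set.Icc (0 : ℝ) 1) : ∫ x, F x ∂ν ∈ Set.Icc (0 : ℝ) 1 := by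
  refine ⟨integral_nonneg fun h => (hb h).1, ?_⟩
  by_cases h : Integrable F ν
  · exact (integral_mono h (integrable_const 1) fun h => (hb h).2).trans (by simp)
  -- Without integrability the integral takes its default value 0, which also lies in the interval;
  -- hence no measurability is needed.
  · rw [integral_undef h]; exact zero_le_one

lemma integral_pi_succ {k : ℕ} {F : (Fin (k + 1) → ℝ) → ℝ} (hF : Measurable F)
    (hb : ∀ h, F h ∈ Set.Icc (0 : ℝ) 1) :
    ∫ h, F h ∂(Measure.pi fun _ : Fin (k + 1) => P)
      = ∫ x, ∫ h, F (Fin.cons x h) ∂(Measure.pi fun _ : Fin k => P) ∂P := by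
  have e := measurePreserving_piFinSuccAbove (fun _ : Fin (k + 1) => P) 0
  rw [← e.symm.integral_comp']
  have h : ∀ p : ℝ × (Fin k → ℝ),
      (MeasurableEquiv.piFinSuccAbove (fun _ : Fin (k + 1) => ℝ) 0).symm p = Fin.cons p.1 p.2 := by
    intro p
    simp [MeasurableEquiv.piFinSuccAbove, Fin.consEquiv]
  rw [integral_prod _ (by
    exact integrable_of_mem_Icc (hF.comp (MeasurableEquiv.measurable _)) (fun _ => hb _))]
  simp only [h]

lemma measurable_fin_cons {k : ℕ} (x : ℝ) :
    Measurable fun h : Fin k → ℝ => (Fin.cons x h : Fin (k + 1) → ℝ) := by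
  refine measurable_pi_lambda _ fun i => ?_
  refine Fin.cases ?_ (fun j => ?_) i
  · simp
  · simpa using measurable_pi_apply j

lemma integral_pi_zero {P : Measure ℝ} (F : (Fin 0 → ℝ) → ℝ) :
    ∫ h, F h ∂(Measure.pi fun _ : Fin 0 => P) = F ![] := by
  rw [Measure.pi_of_empty, integral_dirac]
  congr

lemma integral_pi_three {F : (Fin 3 → ℝ) → ℝ} (hF : Measurable F)
    (hb : ∀ h, F h ∈ Set.Icc (0 : ℝ) 1) :
    ∫ h, F h ∂(Measure.pi fun _ : Fin 3 => P) = ∫ x, ∫ y, ∫ z, F ![x, y, z] ∂P ∂P ∂P := by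
  rw [integral_pi_succ hF hb]
  congr! 2 with x
  rw [integral_pi_succ (by exact hF.comp (measurable_fin_cons _)) (fun _ => hb _)]
  congr! 2 with y
  rw [integral_pi_succ (by exact hF.comp ((measurable_fin_cons _).comp (measurable_fin_cons _)))
    (fun _ => hb _)]
  congr! 2 with z
  rw [integral_pi_zero]
  rfl

lemma integral_pi_four {F : (Fin 4 → ℝ) → ℝ} (hF : Measurable F)
    (hb : ∀ h, F h ∈ Set.Icc (0 : ℝ) 1) :
    ∫ h, F h ∂(Measure.pi fun _ : Fin 4 => P)
      = ∫ x, ∫ y, ∫ z, ∫ w, F ![x, y, z, w] ∂P ∂P ∂P ∂P := by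
  rw [integral_pi_succ hF hb]
  congr! 2 with x
  exact integral_pi_three (by exact hF.comp (measurable_fin_cons _)) (fun _ => hb _)

lemma integral_pi_five {F : (Fin 5 → ℝ) → ℝ} (hF : Measurable F)
    (hb : ∀ h, F h ∈ Set.Icc (0 : ℝ) 1) :
    ∫ h, F h ∂(Measure.pi fun _ : Fin 5 => P)
      = ∫ x, ∫ y, ∫ z, ∫ v, ∫ w, F ![x, y, z, v, w] ∂P ∂P ∂P ∂P ∂P := by
  rw [integral_pi_succ hF hb]
  congr! 2 with x
  exact integral_pi_four (by exact hF.comp (measurable_fin_cons _)) (fun _ => hb _)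

lemma integral_pi_six {F : (Fin 6 → ℝ) → ℝ} (hF : Measurable F)
    (hb : ∀ h, F h ∈ Set.Icc (0 : ℝ) 1) :
    ∫ h, F h ∂(Measure.pi fun _ : Fin 6 => P)
      = ∫ x, ∫ y, ∫ z, ∫ u, ∫ v, ∫ w, F ![x, y, z, u, v, w] ∂P ∂P ∂P ∂P ∂P ∂P := by
  rw [integral_pi_succ hF hb]
  congr! 2 with x
  exact integral_pi_five (by exact hF.comp (measurable_fin_cons _)) (fun _ => hb _)

end Marginals

/-! ### Expected pattern counts and pattern densities -/

section Expectation

variable (τ hmin : ℝ) (n : ℕ)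

/-- The connection probability, truncated below at `0`. -/
noncomputable def edgeProb (x y : ℝ) : ℝ := max 0 (connProb τ hmin n x y)

/-- The connection threshold of an unordered pair of vertices. -/
noncomputable def threshold {ι : Type*} (h : ι → ℝ) : Sym2 ι → ℝ :=
  Sym2.lift ⟨fun i j => connProb τ hmin n (h i) (h j), fun i j => by
    simp only [connProb, mul_comm]⟩

/-- The probability that the pairs in `E` are all joined. -/
noncomputable def patternDensity {k : ℕ} (E : Finset (Sym2 (Fin k))) : ℝ :=
  ∫ h, ∏ e ∈ E, max 0 (threshold τ hmin n h e) ∂(Measure.pi fun _ : Fin k => weightLaw τ hmin)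

/-- The conditional probability that a vertex of weight `x` forms a triangle with two others. -/
noncomputable def triangleProb (x : ℝ) : ℝ :=
  ∫ y, ∫ z, edgeProb τ hmin n x y * edgeProb τ hmin n x z * edgeProb τ hmin n y z
    ∂(weightLaw τ hmin) ∂(weightLaw τ hmin)

variable {τ hmin n}

lemma threshold_mk {ι : Type*} (h : ι → ℝ) (i j : ι) :
    threshold τ hmin n h s(i, j) = connProb τ hmin n (h i) (h j) := rfl

lemma threshold_map {ι κ : Type*} (h : ι → ℝ) (f : κ → ι) (e : Sym2 κ) :
    threshold τ hmin n h (e.map f) = threshold τ hmin n (fun i => h (f i)) e := by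
  induction e with
  | _ a b => rfl

lemma connProb_le_one (x y : ℝ) : connProb τ hmin n x y ≤ 1 := min_le_right _ _

lemma threshold_le_one {ι : Type*} (h : ι → ℝ) (e : Sym2 ι) : threshold τ hmin n h e ≤ 1 := by
  induction e with
  | _ a b => exact connProb_le_one _ _

lemma measurable_threshold {ι : Type*} (e : Sym2 ι) :
    Measurable fun h : ι → ℝ => threshold τ hmin n h e := by
  induction e with
  | _ a b =>
    simp only [threshold_mk, connProb]
    exact ((((measurable_pi_apply a).mul (measurable_pi_apply b)).div_const _).min
      measurable_const)

lemma prod_threshold_mem_Icc {ι : Type*} (E : Finset (Sym2 ι)) (h : ι → ℝ) :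
    ∏ e ∈ E, max 0 (threshold τ hmin n h e) ∈ Set.Icc (0 : ℝ) 1 :=
  ⟨Finset.prod_nonneg fun _ _ => le_max_left _ _,
    Finset.prod_le_one (fun _ _ => le_max_left _ _)
      fun _ _ => max_le zero_le_one (threshold_le_one _ _)⟩

lemma measurable_prod_threshold {ι : Type*} (E : Finset (Sym2 ι)) :
    Measurable fun h : ι → ℝ => ∏ e ∈ E, max 0 (threshold τ hmin n h e) :=
  Finset.measurable_fun_prod _ fun e _ => measurable_const.max (measurable_threshold e)

lemma edgeInd_randomGraph (ω : Sample n) {e : Sym2 (Fin n)} (he : ¬ e.IsDiag) :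
    edgeInd (randomGraph τ hmin n ω) e = if ω.2 e ≤ threshold τ hmin n ω.1 e then 1 else 0 := by
  classical
  induction e with
  | _ a b =>
    have hab : a ≠ b := by simpa using he
    have : s(a, b) ∈ (randomGraph τ hmin n ω).edgeSet ↔
        ω.2 s(a, b) ≤ threshold τ hmin n ω.1 s(a, b) := by
      rw [SimpleGraph.mem_edgeSet, threshold_mk]
      exact ⟨fun h => h.2, fun h => ⟨hab, h⟩⟩
    simp only [edgeInd, this]

lemma patternInd_randomGraph {k : ℕ} {E : Finset (Sym2 (Fin k))} (hE : ∀ e ∈ E, ¬ e.IsDiag)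
    (f : Fin k ↪ Fin n) (ω : Sample n) :
    patternInd E f (randomGraph τ hmin n ω)
      = ∏ e ∈ E, if ω.2 (e.map f) ≤ threshold τ hmin n ω.1 (e.map f) then (1 : ℝ) else 0 := by
  refine Finset.prod_congr rfl fun e he => edgeInd_randomGraph ω ?_
  have := hE e he
  induction e with
  | _ a b => simpa using this

lemma measurable_patternInd {k : ℕ} {E : Finset (Sym2 (Fin k))} (hE : ∀ e ∈ E, ¬ e.IsDiag)
    (f : Fin k ↪ Fin n) :
    Measurable fun ω : Sample n => patternInd E f (randomGraph τ hmin n ω) := by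
  simp_rw [patternInd_randomGraph hE f]
  refine Finset.measurable_fun_prod _ fun e _ => ?_
  exact Measurable.ite (measurableSet_le ((measurable_pi_apply _).comp measurable_snd)
    ((measurable_threshold _).comp measurable_fst)) measurable_const measurable_const

lemma patternInd_mem_Icc {k : ℕ} (E : Finset (Sym2 (Fin k))) (f : Fin k → Fin n)
    (G : SimpleGraph (Fin n)) : patternInd E f G ∈ Set.Icc (0 : ℝ) 1 := by
  classical
  rw [patternInd_eq_ite]; split_ifs <;> simp

lemma isProbabilityMeasure_weightLaw (hτ : 2 < τ) (hhmin : 0 < hmin) :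
    IsProbabilityMeasure (weightLaw τ hmin) :=
  isProbabilityMeasure_paretoMeasure hhmin (by linarith)

instance : IsProbabilityMeasure ((volume : Measure ℝ).restrict (Set.Icc 0 1)) :=
  ⟨by simp⟩

lemma isProbabilityMeasure_sampleLaw (hτ : 2 < τ) (hhmin : 0 < hmin) :
    IsProbabilityMeasure (sampleLaw τ hmin n) := by
  have := isProbabilityMeasure_weightLaw hτ hhmin
  unfold sampleLaw
  infer_instance

lemma integrable_patternInd (hτ : 2 < τ) (hhmin : 0 < hmin) {k : ℕ} {E : Finset (Sym2 (Fin k))}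
    (hE : ∀ e ∈ E, ¬ e.IsDiag) (f : Fin k ↪ Fin n) :
    Integrable (fun ω : Sample n => patternInd E f (randomGraph τ hmin n ω))
      (sampleLaw τ hmin n) := by
  have := isProbabilityMeasure_sampleLaw (n := n) hτ hhmin
  exact integrable_of_mem_Icc (measurable_patternInd hE f) fun _ => patternInd_mem_Icc _ _ _

/-- Integrate the labels first, then the weights. Injectivity of `f` enters twice: distinct pairs
carry distinct, hence independent, labels, and the weights at the image vertices are i.i.d. So the
answer does not depend on `f`. -/
lemma expect_patternInd (hτ : 2 < τ) (hhmin : 0 < hmin) {k : ℕ} {E : Finset (Sym2 (Fin k))}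
    (hE : ∀ e ∈ E, ¬ e.IsDiag) (f : Fin k ↪ Fin n) :
    expect τ hmin n (patternInd E f) = patternDensity τ hmin n E := by
  classical
  have := isProbabilityMeasure_weightLaw hτ hhmin
  have hint := integrable_patternInd (n := n) hτ hhmin hE f
  rw [expect, sampleLaw, integral_prod _ hint]
  simp_rw [patternInd_randomGraph hE f]
  have hinj : Function.Injective (Sym2.map f) := Sym2.map.injective f.injective
  have h1 : ∀ (h : Fin n → ℝ), ∫ u : Sym2 (Fin n) → ℝ,
      ∏ e ∈ E, (if u (e.map f) ≤ threshold τ hmin n h (e.map f) then (1 : ℝ) else 0)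
        ∂(Measure.pi fun _ : Sym2 (Fin n) => (volume : Measure ℝ).restrict (Set.Icc 0 1))
      = ∏ e ∈ E, max 0 (threshold τ hmin n (fun i => h (f i)) e) := by
    intro h
    have := integral_labels (E.image (Sym2.map f)) (threshold_le_one (τ := τ) (hmin := hmin)
      (n := n) h)
    rw [Finset.prod_image hinj.injOn] at this
    simp_rw [Finset.prod_image hinj.injOn] at this
    rw [this]
    simp_rw [threshold_map]
  simp_rw [h1]
  exact integral_pi_comp f (measurable_prod_threshold E)

lemma expect_motifCount (hτ : 2 < τ) (hhmin : 0 < hmin) {k : ℕ} {E : Finset (Sym2 (Fin k))}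
    (hE : ∀ e ∈ E, ¬ e.IsDiag) :
    expect τ hmin n (motifCount (SimpleGraph.fromEdgeSet (E : Set (Sym2 (Fin k)))))
      = n.descFactorial k * patternDensity τ hmin n E := by
  have h1 : expect τ hmin n (motifCount (SimpleGraph.fromEdgeSet (E : Set (Sym2 (Fin k)))))
      = ∑ f : Fin k ↪ Fin n, expect τ hmin n (patternInd E f) := by
    simp only [expect, motifCount_fromEdgeSet E _ hE]
    exact integral_finsetSum _ fun f _ => integrable_patternInd hτ hhmin hE f
  rw [h1, Finset.sum_congr rfl fun f _ => expect_patternInd hτ hhmin hE f, Finset.sum_const,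
    Finset.card_univ, Fintype.card_embedding_eq, nsmul_eq_mul]
  simp

lemma triangleEdges_not_isDiag : ∀ e ∈ triangleEdges, ¬ e.IsDiag := by decide
lemma bowTieEdges_not_isDiag : ∀ e ∈ bowTieEdges, ¬ e.IsDiag := by decide
lemma diamondEdges_not_isDiag : ∀ e ∈ diamondEdges, ¬ e.IsDiag := by decide
lemma twoTriangleEdges_not_isDiag : ∀ e ∈ twoTriangleEdges, ¬ e.IsDiag := by decide

lemma patternDensity_triangle (hτ : 2 < τ) (hhmin : 0 < hmin) :
    patternDensity τ hmin n triangleEdges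
      = ∫ x, triangleProb τ hmin n x ∂(weightLaw τ hmin) := by
  have := isProbabilityMeasure_weightLaw hτ hhmin
  rw [patternDensity, integral_pi_three (measurable_prod_threshold _) (prod_threshold_mem_Icc _)]
  unfold triangleProb
  congr! 6 with x y z
  rw [triangleEdges]
  repeat rw [Finset.prod_insert (by decide)]
  rw [Finset.prod_singleton]
  simp [threshold_mk, edgeProb, mul_assoc]

/-- The two triangles share no vertex, so the sixfold integral factorises. -/
lemma patternDensity_twoTriangles (hτ : 2 < τ) (hhmin : 0 < hmin) :
    patternDensity τ hmin n twoTriangleEdges = patternDensity τ hmin n triangleEdges ^ 2 := by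
  have := isProbabilityMeasure_weightLaw hτ hhmin
  rw [patternDensity_triangle hτ hhmin, patternDensity,
    integral_pi_six (measurable_prod_threshold _) (prod_threshold_mem_Icc _), pow_two]
  unfold triangleProb
  -- Moving each factor under the integrals of the other turns the product into a single iterated
  -- integral that can be compared variable by variable.
  simp_rw [← integral_mul_const]
  simp_rw [← integral_const_mul]
  congr! 12 with x y z u v w
  rw [twoTriangleEdges]
  repeat rw [Finset.prod_insert (by decide)]
  rw [Finset.prod_singleton]
  simp [threshold_mk, edgeProb, mul_assoc]

/-- Given the weight of the centre, the two triangles are independent and equally likely. -/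
lemma patternDensity_bowTie (hτ : 2 < τ) (hhmin : 0 < hmin) :
    patternDensity τ hmin n bowTieEdges
      = ∫ x, triangleProb τ hmin n x ^ 2 ∂(weightLaw τ hmin) := by
  have := isProbabilityMeasure_weightLaw hτ hhmin
  rw [patternDensity,
    integral_pi_five (measurable_prod_threshold _) (prod_threshold_mem_Icc _)]
  congr! 2 with x
  rw [pow_two]
  unfold triangleProb
  simp_rw [← integral_mul_const]
  simp_rw [← integral_const_mul]
  congr! 8 with y z u v
  rw [bowTieEdges]
  repeat rw [Finset.prod_insert (by decide)]
  rw [Finset.prod_singleton]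
  simp [threshold_mk, edgeProb, mul_assoc]

/-- The shared edge is set apart because the estimate of this integral bounds its probability by 1.
-/
lemma patternDensity_diamond :
    patternDensity τ hmin n diamondEdges
      = ∫ h, edgeProb τ hmin n (h 0) (h 1) * (edgeProb τ hmin n (h 0) (h 2) *
          edgeProb τ hmin n (h 1) (h 2) * edgeProb τ hmin n (h 0) (h 3) *
          edgeProb τ hmin n (h 1) (h 3)) ∂(Measure.pi fun _ : Fin 4 => weightLaw τ hmin) := by
  rw [patternDensity]
  congr! 2 with h
  rw [diamondEdges]
  repeat rw [Finset.prod_insert (by decide)]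
  rw [Finset.prod_singleton]
  simp [threshold_mk, edgeProb, mul_assoc]

end Expectation

/-! ### The exact variance -/

section Variance

open Finset

variable {τ hmin : ℝ} {n : ℕ}

lemma var_const_mul (c : ℝ) (X : SimpleGraph (Fin n) → ℝ) :
    var τ hmin n (fun G => c * X G) = c ^ 2 * var τ hmin n X :=
  variance_const_mul _ _ _

lemma expect_const_mul (c : ℝ) (X : SimpleGraph (Fin n) → ℝ) :
    expect τ hmin n (fun G => c * X G) = c * expect τ hmin n X :=
  integral_const_mul _ _

/-- The probability that the three-element sets `s` and `t` with `k` common elements are both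
cliques. -/
noncomputable def pairDensity (τ hmin : ℝ) (n : ℕ) : ℕ → ℝ
  | 0 => patternDensity τ hmin n triangleEdges ^ 2
  | 1 => patternDensity τ hmin n bowTieEdges
  | 2 => patternDensity τ hmin n diamondEdges
  | _ => patternDensity τ hmin n triangleEdges

/-- A uniform treatment of the four overlap sizes, so that integrability and expectation need no
further case distinction. -/
lemma exists_pattern_of_pair (hτ : 2 < τ) (hhmin : 0 < hmin) {s t : Finset (Fin n)}
    (hs : s.card = 3) (ht : t.card = 3) :
    ∃ (k : ℕ) (E : Finset (Sym2 (Fin k))) (f : Fin k ↪ Fin n), (∀ e ∈ E, ¬ e.IsDiag) ∧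
      (∀ G, cliqueInd s G * cliqueInd t G = patternInd E f G) ∧
      patternDensity τ hmin n E = pairDensity τ hmin n (s ∩ t).card := by
  have h3 : (s ∩ t).card ≤ 3 := (card_le_card inter_subset_left).trans hs.le
  obtain h | h | h | h : (s ∩ t).card = 0 ∨ (s ∩ t).card = 1 ∨ (s ∩ t).card = 2 ∨
      (s ∩ t).card = 3 := by omega
  · obtain ⟨f, hf⟩ := cliqueInd_mul_of_card_inter_zero hs ht h
    exact ⟨_, _, f, twoTriangleEdges_not_isDiag, hf, by
      rw [h, patternDensity_twoTriangles hτ hhmin]; rfl⟩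
  · obtain ⟨f, hf⟩ := cliqueInd_mul_of_card_inter_one hs ht h
    exact ⟨_, _, f, bowTieEdges_not_isDiag, hf, by rw [h]; rfl⟩
  · obtain ⟨f, hf⟩ := cliqueInd_mul_of_card_inter_two hs ht h
    exact ⟨_, _, f, diamondEdges_not_isDiag, hf, by rw [h]; rfl⟩
  · have h1 : s ∩ t = s := eq_of_subset_of_card_le inter_subset_left (by omega)
    have h2 : s ∩ t = t := eq_of_subset_of_card_le inter_subset_right (by omega)
    obtain rfl : s = t := h1.symm.trans h2
    obtain ⟨f, hf⟩ := cliqueInd_eq_patternInd hs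
    exact ⟨_, _, f, triangleEdges_not_isDiag, fun G => by rw [cliqueInd_mul_self, hf], by
      rw [h]; rfl⟩

lemma integrable_cliqueInd_mul (hτ : 2 < τ) (hhmin : 0 < hmin) {s t : Finset (Fin n)}
    (hs : s.card = 3) (ht : t.card = 3) :
    Integrable (fun ω => cliqueInd s (randomGraph τ hmin n ω) *
      cliqueInd t (randomGraph τ hmin n ω)) (sampleLaw τ hmin n) := by
  obtain ⟨k, E, f, hE, hf, -⟩ := exists_pattern_of_pair (τ := τ) hτ hhmin hs ht
  simp_rw [hf]
  exact integrable_patternInd hτ hhmin hE f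

lemma integral_cliqueInd_mul (hτ : 2 < τ) (hhmin : 0 < hmin) {s t : Finset (Fin n)}
    (hs : s.card = 3) (ht : t.card = 3) :
    ∫ ω, cliqueInd s (randomGraph τ hmin n ω) *
      cliqueInd t (randomGraph τ hmin n ω) ∂(sampleLaw τ hmin n)
      = pairDensity τ hmin n (s ∩ t).card := by
  obtain ⟨k, E, f, hE, hf, hd⟩ := exists_pattern_of_pair (τ := τ) hτ hhmin hs ht
  simp_rw [hf]
  rw [← hd]
  exact expect_patternInd hτ hhmin hE f

lemma integral_triangleCount_sq (hτ : 2 < τ) (hhmin : 0 < hmin) :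
    ∫ ω, triangleCount (randomGraph τ hmin n ω) ^ 2 ∂(sampleLaw τ hmin n)
      = n.choose 3 * ∑ k ∈ range 4, (Nat.choose 3 k * Nat.choose (n - 3) (3 - k) : ℕ)
          * pairDensity τ hmin n k := by
  have h1 : ∀ G : SimpleGraph (Fin n), triangleCount G ^ 2
      = ∑ s ∈ powersetCard 3 univ, ∑ t ∈ powersetCard 3 univ, cliqueInd s G * cliqueInd t G := by
    intro G
    rw [triangleCount_eq_sum, pow_two, sum_mul_sum]
  simp_rw [h1]
  have hc : ∀ {s : Finset (Fin n)}, s ∈ powersetCard 3 univ → s.card = 3 :=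
    fun hs => (mem_powersetCard.1 hs).2
  rw [integral_finsetSum _ fun s hs => integrable_finsetSum _ fun t ht =>
    integrable_cliqueInd_mul hτ hhmin (hc hs) (hc ht)]
  have h2 : ∀ s ∈ powersetCard 3 (univ : Finset (Fin n)),
      ∫ ω, ∑ t ∈ powersetCard 3 univ, cliqueInd s (randomGraph τ hmin n ω) *
        cliqueInd t (randomGraph τ hmin n ω) ∂(sampleLaw τ hmin n)
      = ∑ k ∈ range 4, (Nat.choose 3 k * Nat.choose (n - 3) (3 - k) : ℕ)
          * pairDensity τ hmin n k := by
    intro s hs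
    rw [integral_finsetSum _ fun t ht => integrable_cliqueInd_mul hτ hhmin (hc hs) (hc ht),
      sum_congr rfl fun t ht => integral_cliqueInd_mul hτ hhmin (hc hs) (hc ht)]
    have hmaps : ∀ t ∈ powersetCard 3 (univ : Finset (Fin n)), (s ∩ t).card ∈ range 4 := by
      intro t _
      have := card_le_card (inter_subset_left : s ∩ t ⊆ s)
      rw [hc hs] at this
      simp; omega
    rw [← sum_fiberwise_of_maps_to hmaps]
    refine sum_congr rfl fun k hk => ?_
    rw [← card_filter_card_inter (hc hs) (by simp at hk; omega),
      sum_congr rfl fun t ht => by rw [(mem_filter.1 ht).2], sum_const, nsmul_eq_mul]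
  rw [sum_congr rfl h2, sum_const, card_powersetCard, nsmul_eq_mul]
  simp

lemma expect_triangleCount (hτ : 2 < τ) (hhmin : 0 < hmin) :
    6 * expect τ hmin n triangleCount
      = n.descFactorial 3 * patternDensity τ hmin n triangleEdges := by
  rw [← expect_motifCount hτ hhmin triangleEdges_not_isDiag, ← triangle_eq, ← expect_const_mul]
  congr 1
  exact funext fun G => (motifCount_triangle G).symm

lemma memLp_triangleCount (hτ : 2 < τ) (hhmin : 0 < hmin) :
    MemLp (fun ω => triangleCount (randomGraph τ hmin n ω)) 2 (sampleLaw τ hmin n) := by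
  have := isProbabilityMeasure_sampleLaw (n := n) hτ hhmin
  simp_rw [triangleCount_eq_sum]
  refine memLp_finsetSum _ fun s hs => ?_
  obtain ⟨f, hf⟩ := cliqueInd_eq_patternInd (mem_powersetCard.1 hs).2
  simp_rw [hf]
  refine MemLp.of_bound (measurable_patternInd triangleEdges_not_isDiag f).aestronglyMeasurable 1
    (ae_of_all _ fun ω => ?_)
  have := patternInd_mem_Icc triangleEdges f (randomGraph τ hmin n ω)
  rw [Real.norm_of_nonneg this.1]
  exact this.2

/-- The exact variance of the number of labelled triangles. -/
lemma var_motifCount_triangle (hτ : 2 < τ) (hhmin : 0 < hmin) :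
    var τ hmin n (motifCount triangle)
      = 9 * expect τ hmin n (motifCount bowTie) + 18 * expect τ hmin n (motifCount diamond)
        + 6 * expect τ hmin n (motifCount triangle)
        - (9 * n.descFactorial 5 + 18 * n.descFactorial 4 + 6 * n.descFactorial 3)
          * patternDensity τ hmin n triangleEdges ^ 2 := by
  have := isProbabilityMeasure_sampleLaw (n := n) hτ hhmin
  have hN : (motifCount triangle : SimpleGraph (Fin n) → ℝ) = fun G => 6 * triangleCount G :=
    funext fun G => motifCount_triangle G
  rw [hN, var_const_mul, var, variance_eq_sub (memLp_triangleCount hτ hhmin), ← hN, bowTie_eq,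
    diamond_eq, triangle_eq, expect_motifCount hτ hhmin bowTieEdges_not_isDiag,
    expect_motifCount hτ hhmin diamondEdges_not_isDiag,
    expect_motifCount hτ hhmin triangleEdges_not_isDiag]
  have hE := expect_triangleCount (n := n) hτ hhmin
  have h2 := integral_triangleCount_sq (n := n) hτ hhmin
  simp only [expect] at hE
  simp only [Pi.pow_apply]
  rw [h2]
  set t := patternDensity τ hmin n triangleEdges
  have hE' : (6 : ℝ) ^ 2 * (∫ ω, triangleCount (randomGraph τ hmin n ω) ∂(sampleLaw τ hmin n)) ^ 2
      = (n.descFactorial 3 * t) ^ 2 := by rw [← hE]; ring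
  rw [mul_sub, hE']
  have h0 : pairDensity τ hmin n 0 = t ^ 2 := rfl
  have h1 : pairDensity τ hmin n 1 = patternDensity τ hmin n bowTieEdges := rfl
  have h2 : pairDensity τ hmin n 2 = patternDensity τ hmin n diamondEdges := rfl
  have h3 : pairDensity τ hmin n 3 = t := rfl
  simp only [sum_range_succ, range_zero, sum_empty, zero_add, h0, h1, h2, h3]
  obtain hn | hn := lt_or_ge n 3
  · have d3 : n.descFactorial 3 = 0 := Nat.descFactorial_eq_zero_iff_lt.2 (by omega)
    have d4 : n.descFactorial 4 = 0 := Nat.descFactorial_eq_zero_iff_lt.2 (by omega)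
    have d5 : n.descFactorial 5 = 0 := Nat.descFactorial_eq_zero_iff_lt.2 (by omega)
    rw [Nat.choose_eq_zero_of_lt hn, d3, d4, d5]
    simp
  · obtain ⟨m, rfl⟩ := Nat.exists_eq_add_of_le' hn
    rw [Nat.add_sub_cancel]
    have c3 : (6 : ℝ) * (m + 3).choose 3 = (m + 3) * (m + 2) * (m + 1) := by
      have := Nat.descFactorial_eq_factorial_mul_choose (m + 3) 3
      have h := congrArg (Nat.cast : ℕ → ℝ) this
      simp [Nat.descFactorial, Nat.factorial] at h
      linarith
    have b3 : (6 : ℝ) * m.choose 3 = m * (m - 1) * (m - 2) := by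
      have := Nat.descFactorial_eq_factorial_mul_choose m 3
      have h := congrArg (Nat.cast : ℕ → ℝ) this
      rcases m with _ | _ | m
      · simp
      · simp [Nat.choose]
      · simp [Nat.descFactorial, Nat.factorial] at h ⊢
        linarith
    have b2 : (2 : ℝ) * m.choose 2 = m * (m - 1) := by
      rw [Nat.cast_choose_two]; ring
    have e3 : ((m + 3).descFactorial 3 : ℝ) = (m + 3) * (m + 2) * (m + 1) := by
      simp [Nat.descFactorial]; ring
    have e4 : ((m + 3).descFactorial 4 : ℝ) = (m + 3) * (m + 2) * (m + 1) * m := by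
      simp [Nat.descFactorial]; ring
    have e5 : ((m + 3).descFactorial 5 : ℝ) = (m + 3) * (m + 2) * (m + 1) * m * (m - 1) := by
      rcases m with _ | m
      · simp [Nat.descFactorial]
      · simp [Nat.descFactorial]; ring
    have k0 : Nat.choose 3 0 = 1 := rfl
    have k1 : Nat.choose 3 1 = 3 := rfl
    have k2 : Nat.choose 3 2 = 3 := rfl
    have k3 : Nat.choose 3 3 = 1 := rfl
    simp only [k0, k1, k2, k3, Nat.sub_zero, Nat.reduceSub, Nat.choose_one_right,
      Nat.choose_zero_right, Nat.cast_mul, Nat.cast_one, Nat.cast_ofNat, one_mul, mul_one]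
    rw [e3, e4, e5]
    set bt := patternDensity τ hmin (m + 3) bowTieEdges
    set d := patternDensity τ hmin (m + 3) diamondEdges
    set q : ℝ := (m + 3) * (m + 2) * (m + 1)
    have hq : q = (m + 3) * (m + 2) * (m + 1) := rfl
    have : (6 : ℝ) ^ 2 * (((m + 3).choose 3 : ℝ) * ((m.choose 3 : ℝ) * t ^ 2
        + 3 * (m.choose 2 : ℝ) * bt + 3 * (m : ℝ) * d + t))
        = q * (m * (m - 1) * (m - 2) * t ^ 2 + 9 * (m * (m - 1)) * bt + 18 * m * d + 6 * t) := by
      rw [← c3, ← b3, ← b2]; ring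
    rw [this]
    clear_value q bt d t
    -- The bow-tie, diamond and triangle terms match; the coefficients of `t ^ 2` agree because
    -- (m+3)(m+2)(m+1) = m(m-1)(m-2) + 9m(m-1) + 18m + 6.
    linear_combination (-(t ^ 2) * q) * hq

end Variance

/-! ### Truncated moments of the Pareto law -/

section Moments

variable {τ hmin : ℝ}

/-- The normalising constant of the density of a hidden variable. -/
noncomputable def densityConst (τ hmin : ℝ) : ℝ := (τ - 1) * hmin ^ (τ - 1)

lemma densityConst_pos (hτ : 2 < τ) (hhmin : 0 < hmin) : 0 < densityConst τ hmin :=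
  mul_pos (by linarith) (Real.rpow_pos_of_pos hhmin _)

lemma weightLaw_eq_withDensity :
    weightLaw τ hmin = ((volume : Measure ℝ).restrict (Set.Ioi hmin)).withDensity
      fun x => ENNReal.ofReal (densityConst τ hmin * x ^ (-τ)) := by
  rw [Measure.restrict_congr_set Ioi_ae_eq_Ici, ← withDensity_indicator measurableSet_Ici, weightLaw,
    paretoMeasure]
  congr 1
  ext x
  rw [paretoPDF_eq, Set.indicator_apply]
  simp only [Set.mem_Ici, sub_add_cancel, densityConst]
  split_ifs <;> simp

lemma ae_weightLaw_gt : ∀ᵐ x ∂(weightLaw τ hmin), hmin < x := by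
  rw [weightLaw_eq_withDensity]
  exact (withDensity_absolutelyContinuous _ _).ae_le (ae_restrict_mem measurableSet_Ioi)

lemma measurable_density :
    Measurable fun x : ℝ => ENNReal.ofReal (densityConst τ hmin * x ^ (-τ)) :=
  ((measurable_id.pow_const _).const_mul _).ennreal_ofReal

lemma density_smul_rpow (hτ : 2 < τ) (hhmin : 0 < hmin) (a : ℝ) {x : ℝ} (hx : hmin < x) :
    (ENNReal.ofReal (densityConst τ hmin * x ^ (-τ))).toReal • x ^ a
      = densityConst τ hmin * x ^ (a - τ) := by
  have hx0 : 0 < x := hhmin.trans hx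
  rw [ENNReal.toReal_ofReal (mul_nonneg (densityConst_pos hτ hhmin).le
    (Real.rpow_nonneg hx0.le _)), smul_eq_mul, mul_assoc, ← Real.rpow_add hx0]
  ring_nf

lemma integrableOn_rpow_weightLaw (hτ : 2 < τ) (hhmin : 0 < hmin) (a : ℝ) {s : Set ℝ}
    (hs : MeasurableSet s) (h : IntegrableOn (fun x => x ^ (a - τ)) (s ∩ Set.Ioi hmin)) :
    IntegrableOn (fun x => x ^ a) s (weightLaw τ hmin) := by
  rw [IntegrableOn, weightLaw_eq_withDensity, restrict_withDensity hs,
    Measure.restrict_restrict hs,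
    integrable_withDensity_iff_integrable_smul' measurable_density (by simp)]
  refine IntegrableOn.congr_fun (Integrable.const_mul h (densityConst τ hmin)) ?_
    (hs.inter measurableSet_Ioi)
  intro x hx
  exact (density_smul_rpow hτ hhmin a hx.2).symm

lemma setIntegral_rpow_weightLaw (hτ : 2 < τ) (hhmin : 0 < hmin) (a : ℝ) {s : Set ℝ}
    (hs : MeasurableSet s) :
    ∫ x in s, x ^ a ∂(weightLaw τ hmin)
      = densityConst τ hmin * ∫ x in s ∩ Set.Ioi hmin, x ^ (a - τ) := by
  rw [weightLaw_eq_withDensity, restrict_withDensity hs, Measure.restrict_restrict hs,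
    integral_withDensity_eq_integral_toReal_smul measurable_density (by simp),
    ← integral_const_mul]
  refine setIntegral_congr_fun (hs.inter measurableSet_Ioi) fun x hx => ?_
  exact density_smul_rpow hτ hhmin a hx.2

lemma integrable_rpow_weightLaw (hτ : 2 < τ) (hhmin : 0 < hmin) {a : ℝ} (ha : a < τ - 1) :
    Integrable (fun x => x ^ a) (weightLaw τ hmin) := by
  rw [← integrableOn_univ]
  refine integrableOn_rpow_weightLaw hτ hhmin a MeasurableSet.univ ?_
  rw [Set.univ_inter]
  exact integrableOn_Ioi_rpow_of_lt (by linarith) hhmin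

/-- Below the critical exponent `τ - 1` a truncated moment is governed by the cut-off from above;
`setIntegral_Iic_rpow_le` is the mirror image beyond it. -/
lemma setIntegral_Ioi_rpow_le (hτ : 2 < τ) (hhmin : 0 < hmin) {a : ℝ} (ha : a < τ - 1) :
    ∃ K > 0, ∀ t > 0, ∫ x in Set.Ioi t, x ^ a ∂(weightLaw τ hmin) ≤ K * t ^ (a - (τ - 1)) := by
  have hC := densityConst_pos hτ hhmin
  refine ⟨densityConst τ hmin / (τ - 1 - a), div_pos hC (by linarith), fun t ht => ?_⟩
  rw [setIntegral_rpow_weightLaw hτ hhmin a measurableSet_Ioi]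
  have h1 : ∫ x in Set.Ioi t ∩ Set.Ioi hmin, x ^ (a - τ) ≤ ∫ x in Set.Ioi t, x ^ (a - τ) := by
    refine setIntegral_mono_set (integrableOn_Ioi_rpow_of_lt (by linarith) ht) ?_
      (Set.inter_subset_left.eventuallyLE)
    filter_upwards [ae_restrict_mem measurableSet_Ioi] with x hx
    exact Real.rpow_nonneg (ht.trans hx).le _
  rw [integral_Ioi_rpow_of_lt (by linarith) ht] at h1
  refine (mul_le_mul_of_nonneg_left h1 hC.le).trans_eq ?_
  have : a - τ + 1 = -(τ - 1 - a) := by ring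
  rw [show a - (τ - 1) = a - τ + 1 by ring, this, neg_div_neg_eq]
  ring

lemma integrableOn_Ioc_rpow {q : ℝ} (hq : -1 < q) {t : ℝ} (ht : 0 ≤ t) :
    IntegrableOn (fun x : ℝ => x ^ q) (Set.Ioc 0 t) :=
  (intervalIntegrable_iff_integrableOn_Ioc_of_le ht).1 (intervalIntegral.intervalIntegrable_rpow' hq)

lemma Iic_inter_Ioi_subset (hhmin : 0 < hmin) (t : ℝ) :
    Set.Iic t ∩ Set.Ioi hmin ⊆ Set.Ioc 0 t :=
  fun _ hx => ⟨hhmin.trans hx.2, hx.1⟩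

lemma integrableOn_Iic_rpow_weightLaw (hτ : 2 < τ) (hhmin : 0 < hmin) {a : ℝ} (ha : τ - 1 < a)
    {t : ℝ} (ht : 0 ≤ t) : IntegrableOn (fun x => x ^ a) (Set.Iic t) (weightLaw τ hmin) :=
  integrableOn_rpow_weightLaw hτ hhmin a measurableSet_Iic
    ((integrableOn_Ioc_rpow (by linarith) ht).mono_set (Iic_inter_Ioi_subset hhmin t))

lemma setIntegral_Iic_rpow_le (hτ : 2 < τ) (hhmin : 0 < hmin) {a : ℝ} (ha : τ - 1 < a) :
    ∃ K > 0, ∀ t > 0, ∫ x in Set.Iic t, x ^ a ∂(weightLaw τ hmin) ≤ K * t ^ (a - (τ - 1)) := by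
  have hC := densityConst_pos hτ hhmin
  refine ⟨densityConst τ hmin / (a - (τ - 1)), div_pos hC (by linarith), fun t ht => ?_⟩
  rw [setIntegral_rpow_weightLaw hτ hhmin a measurableSet_Iic]
  -- Since `a - τ > -1` the domain may be enlarged down to 0, which yields a bound for all `t > 0`,
  -- also below `hmin`.
  have h1 : ∫ x in Set.Iic t ∩ Set.Ioi hmin, x ^ (a - τ) ≤ ∫ x in Set.Ioc 0 t, x ^ (a - τ) := by
    refine setIntegral_mono_set (integrableOn_Ioc_rpow (by linarith) ht.le) ?_
      (Iic_inter_Ioi_subset hhmin t).eventuallyLE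
    filter_upwards [ae_restrict_mem measurableSet_Ioc] with x hx
    exact Real.rpow_nonneg hx.1.le _
  rw [← intervalIntegral.integral_of_le ht.le, integral_rpow (Or.inl (by linarith)),
    Real.zero_rpow (by linarith), sub_zero] at h1
  refine (mul_le_mul_of_nonneg_left h1 hC.le).trans_eq ?_
  rw [show a - (τ - 1) = a - τ + 1 by ring]
  ring

lemma setIntegral_Ioc_rpow (hτ : 2 < τ) (hhmin : 0 < hmin) (a : ℝ) {b c : ℝ} (hb : hmin ≤ b)
    (hbc : b ≤ c) :
    ∫ x in Set.Ioc b c, x ^ a ∂(weightLaw τ hmin)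
      = densityConst τ hmin * ∫ x in b..c, x ^ (a - τ) := by
  rw [setIntegral_rpow_weightLaw hτ hhmin a measurableSet_Ioc, Set.inter_eq_left.2,
    intervalIntegral.integral_of_le hbc]
  exact fun x hx => hb.trans_lt hx.1

lemma integrableOn_Ioc_rpow_weightLaw (hτ : 2 < τ) (hhmin : 0 < hmin) (a : ℝ) {b : ℝ} (hb : 0 < b)
    (c : ℝ) : IntegrableOn (fun x => x ^ a) (Set.Ioc b c) (weightLaw τ hmin) := by
  refine integrableOn_rpow_weightLaw hτ hhmin a measurableSet_Ioc ?_
  refine IntegrableOn.mono_set (t := Set.Icc b c) ?_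
    (Set.inter_subset_left.trans Set.Ioc_subset_Icc_self)
  refine ContinuousOn.integrableOn_Icc fun x hx => ?_
  exact (Real.continuousAt_rpow_const _ _ (Or.inl (hb.trans_le hx.1).ne')).continuousWithinAt

lemma measureReal_Ioi (hτ : 2 < τ) (hhmin : 0 < hmin) {t : ℝ} (ht : hmin ≤ t) :
    (weightLaw τ hmin).real (Set.Ioi t) = (hmin / t) ^ (τ - 1) := by
  have ht0 : 0 < t := hhmin.trans_le ht
  have h := setIntegral_rpow_weightLaw hτ hhmin 0 (measurableSet_Ioi (a := t))
  rw [Set.inter_eq_left.2 (Set.Ioi_subset_Ioi ht),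
    integral_Ioi_rpow_of_lt (by linarith) ht0] at h
  simp only [Real.rpow_zero] at h
  rw [setIntegral_const, smul_eq_mul, mul_one] at h
  rw [h, densityConst, Real.div_rpow hhmin.le ht0.le, show 0 - τ + 1 = -(τ - 1) by ring,
    neg_div_neg_eq, Real.rpow_neg ht0.le]
  have : τ - 1 ≠ 0 := by linarith
  field_simp

lemma meanWeight_pos (hτ : 2 < τ) (hhmin : 0 < hmin) : 0 < meanWeight τ hmin := by
  have := isProbabilityMeasure_weightLaw hτ hhmin
  have hi : Integrable (fun x : ℝ => x) (weightLaw τ hmin) := by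
    simpa using integrable_rpow_weightLaw hτ hhmin (a := 1) (by linarith)
  have : ∫ _, hmin ∂(weightLaw τ hmin) ≤ ∫ x, x ∂(weightLaw τ hmin) :=
    integral_mono_ae (integrable_const _) hi (ae_weightLaw_gt.mono fun x hx => hx.le)
  simp at this
  exact hhmin.trans_le this

end Moments

/-! ### Pointwise bounds on the triangle probability -/

section Kernel

variable {τ hmin N : ℝ}

/-- The connection kernel `min (x y / N) 1`, truncated below at `0`. -/
noncomputable def kernel (N x y : ℝ) : ℝ := max 0 (min (x * y / N) 1)

/-- The probability, in terms of the connection kernel, that a vertex of weight `x` forms a triangle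
with two others. -/
noncomputable def kernelTriangle (τ hmin N x : ℝ) : ℝ :=
  ∫ y, ∫ z, kernel N x y * kernel N x z * kernel N y z ∂(weightLaw τ hmin) ∂(weightLaw τ hmin)

lemma kernel_nonneg (N x y : ℝ) : 0 ≤ kernel N x y := le_max_left _ _

lemma kernel_le_one (N x y : ℝ) : kernel N x y ≤ 1 := max_le zero_le_one (min_le_right _ _)

@[fun_prop]
lemma measurable_kernel {α : Type*} [MeasurableSpace α] {f g : α → ℝ} (hf : Measurable f)
    (hg : Measurable g) : Measurable fun a => kernel N (f a) (g a) :=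
  measurable_const.max (((hf.mul hg).div_const _).min measurable_const)

lemma kernel_le_div (hN : 0 < N) {x y : ℝ} (hx : 0 < x) (hy : 0 < y) :
    kernel N x y ≤ x * y / N :=
  max_le (by positivity) (min_le_left _ _)

/-- Interpolation between the bounds `a` and 1 for min(a,1). The free exponent `s` is tuned
separately in each range of weights. -/
lemma kernel_le_rpow (hN : 0 < N) {x y s : ℝ} (hx : 0 < x) (hy : 0 < y) (hs : 0 ≤ s)
    (hs1 : s ≤ 1) : kernel N x y ≤ (x * y / N) ^ s := by
  have ha : 0 < x * y / N := by positivity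
  obtain h | h := le_total (x * y / N) 1
  · refine (kernel_le_div hN hx hy).trans ?_
    simpa using Real.rpow_le_rpow_of_exponent_ge ha h hs1
  · exact (kernel_le_one _ _ _).trans (Real.one_le_rpow h hs)

lemma le_kernel {x y a : ℝ} (h : a ≤ x * y / N) (h1 : a ≤ 1) : a ≤ kernel N x y :=
  le_max_of_le_right (le_min h h1)

lemma integrable_rpow_mul_kernel (hτ : 2 < τ) (hhmin : 0 < hmin) {s : ℝ} (hs : s < τ - 1)
    (x : ℝ) : Integrable (fun y => y ^ s * kernel N x y) (weightLaw τ hmin) := by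
  refine (integrable_rpow_weightLaw hτ hhmin hs).mul_bdd (c := 1) ?_ ?_
  · exact (measurable_kernel measurable_const measurable_id).aestronglyMeasurable
  · exact ae_of_all _ fun _ => by
      rw [Real.norm_of_nonneg (kernel_nonneg _ _ _)]; exact kernel_le_one _ _ _

lemma integral_rpow_mul_kernel_nonneg (hhmin : 0 < hmin) (s x : ℝ) :
    0 ≤ ∫ y, y ^ s * kernel N x y ∂(weightLaw τ hmin) :=
  integral_nonneg_of_ae (ae_weightLaw_gt.mono fun _ hy =>
    mul_nonneg (Real.rpow_nonneg (hhmin.trans hy).le _) (kernel_nonneg _ _ _))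

/-- Split at `y = N / x`, where the kernel saturates. Below, use `x * y / N` and the moment of order
`s + 1 > τ - 1`; above, use 1 and the moment of order `s < τ - 1`. Both are governed by the
splitting point and give the same power. -/
lemma integral_rpow_mul_kernel_le (hτ : 2 < τ) (hhmin : 0 < hmin) {s : ℝ} (hs : τ - 2 < s)
    (hs1 : s < τ - 1) :
    ∃ K > 0, ∀ N > 0, ∀ x > 0,
      ∫ y, y ^ s * kernel N x y ∂(weightLaw τ hmin) ≤ K * (x / N) ^ (τ - 1 - s) := by
  obtain ⟨K₁, hK₁, h₁⟩ := setIntegral_Ioi_rpow_le hτ hhmin hs1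
  obtain ⟨K₂, hK₂, h₂⟩ := setIntegral_Iic_rpow_le hτ hhmin (a := s + 1) (by linarith)
  refine ⟨K₁ + K₂, by positivity, fun N hN x hx => ?_⟩
  have hi := integrable_rpow_mul_kernel (N := N) hτ hhmin hs1 x
  have ht : 0 < N / x := by positivity
  rw [← integral_add_compl (measurableSet_Iic (a := N / x)) hi, Set.compl_Iic]
  have e₂ : ∫ y in Set.Iic (N / x), y ^ s * kernel N x y ∂(weightLaw τ hmin)
      ≤ (x / N) * ∫ y in Set.Iic (N / x), y ^ (s + 1) ∂(weightLaw τ hmin) := by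
    rw [← integral_const_mul]
    refine setIntegral_mono_ae hi.integrableOn
      ((integrableOn_Iic_rpow_weightLaw hτ hhmin (by linarith) ht.le).const_mul _)
      (ae_weightLaw_gt.mono fun y hy => ?_)
    have hy0 : 0 < y := hhmin.trans hy
    simp only
    rw [Real.rpow_add hy0, Real.rpow_one]
    calc y ^ s * kernel N x y ≤ y ^ s * (x * y / N) :=
          mul_le_mul_of_nonneg_left (kernel_le_div hN hx hy0) (Real.rpow_nonneg hy0.le _)
      _ = _ := by ring
  have e₁ : ∫ y in Set.Ioi (N / x), y ^ s * kernel N x y ∂(weightLaw τ hmin)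
      ≤ ∫ y in Set.Ioi (N / x), y ^ s ∂(weightLaw τ hmin) := by
    refine setIntegral_mono_ae hi.integrableOn
      (integrable_rpow_weightLaw hτ hhmin hs1).integrableOn
      (ae_weightLaw_gt.mono fun y hy => ?_)
    exact mul_le_of_le_one_right (Real.rpow_nonneg (hhmin.trans hy).le _) (kernel_le_one _ _ _)
  have f₁ := h₁ _ ht
  have f₂ := h₂ _ ht
  have hinv : N / x = (x / N)⁻¹ := (inv_div _ _).symm
  have hxN : 0 < x / N := by positivity
  have g₁ : (N / x) ^ (s - (τ - 1)) = (x / N) ^ (τ - 1 - s) := by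
    rw [hinv, Real.inv_rpow hxN.le, ← Real.rpow_neg hxN.le]; ring_nf
  have g₂ : (x / N) * (N / x) ^ (s + 1 - (τ - 1)) = (x / N) ^ (τ - 1 - s) := by
    rw [hinv, Real.inv_rpow hxN.le, ← Real.rpow_neg hxN.le]
    nth_rewrite 1 [← Real.rpow_one (x / N)]
    rw [← Real.rpow_add hxN]; ring_nf
  rw [g₁] at f₁
  have f₂' := mul_le_mul_of_nonneg_left f₂ hxN.le
  rw [mul_left_comm, g₂] at f₂'
  linarith

lemma kernel_mul_mem_Icc (x y z : ℝ) :
    kernel N x y * kernel N x z * kernel N y z ∈ Set.Icc (0 : ℝ) 1 := by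
  have h := kernel_nonneg N
  have h1 := kernel_le_one N
  exact ⟨mul_nonneg (mul_nonneg (h _ _) (h _ _)) (h _ _),
    mul_le_one₀ (mul_le_one₀ (h1 _ _) (h _ _) (h1 _ _)) (h _ _) (h1 _ _)⟩

lemma kernelTriangle_mem_Icc (hτ : 2 < τ) (hhmin : 0 < hmin) (x : ℝ) :
    kernelTriangle τ hmin N x ∈ Set.Icc (0 : ℝ) 1 := by
  have := isProbabilityMeasure_weightLaw hτ hhmin
  exact integral_mem_Icc fun y => integral_mem_Icc fun z => kernel_mul_mem_Icc x y z

lemma measurable_kernelTriangle (hτ : 2 < τ) (hhmin : 0 < hmin) :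
    Measurable (kernelTriangle τ hmin N) := by
  have := isProbabilityMeasure_weightLaw hτ hhmin
  refine measurable_integral_right ?_
  refine measurable_integral_right
    (F := fun (p : ℝ × ℝ) z => kernel N p.1 p.2 * kernel N p.1 z * kernel N p.2 z) ?_
  fun_prop

lemma integrable_kernelTriangle_inner (hτ : 2 < τ) (hhmin : 0 < hmin) (x y : ℝ) :
    Integrable (fun z => kernel N x y * kernel N x z * kernel N y z) (weightLaw τ hmin) := by
  have := isProbabilityMeasure_weightLaw hτ hhmin
  refine integrable_of_mem_Icc ?_ fun z => kernel_mul_mem_Icc x y z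
  fun_prop

lemma integrable_kernelTriangle_outer (hτ : 2 < τ) (hhmin : 0 < hmin) (x : ℝ) :
    Integrable (fun y => ∫ z, kernel N x y * kernel N x z * kernel N y z ∂(weightLaw τ hmin))
      (weightLaw τ hmin) := by
  have := isProbabilityMeasure_weightLaw hτ hhmin
  refine integrable_of_mem_Icc (measurable_integral_right ?_)
    fun y => integral_mem_Icc fun z => kernel_mul_mem_Icc x y z
  fun_prop

lemma integrable_kernelTriangle (hτ : 2 < τ) (hhmin : 0 < hmin) :
    Integrable (kernelTriangle τ hmin N) (weightLaw τ hmin) := by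
  have := isProbabilityMeasure_weightLaw hτ hhmin
  exact integrable_of_mem_Icc (measurable_kernelTriangle hτ hhmin)
    (kernelTriangle_mem_Icc hτ hhmin)

/-- Bounding the factor `kernel N y z` by `(y * z / N) ^ s` decouples `y` from `z`, and the double
integral becomes a square. -/
lemma kernelTriangle_le_sq (hτ : 2 < τ) (hhmin : 0 < hmin) (hN : 0 < N) {s : ℝ} (hs0 : 0 ≤ s)
    (hs1 : s ≤ 1) (x : ℝ) :
    kernelTriangle τ hmin N x
      ≤ N ^ (-s) * (∫ y, y ^ s * kernel N x y ∂(weightLaw τ hmin)) ^ 2 := by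
  have hs : s < τ - 1 := by linarith
  have hi := integrable_rpow_mul_kernel (N := N) hτ hhmin hs x
  rw [pow_two, ← integral_mul_const, ← integral_const_mul]
  refine integral_mono_ae (integrable_kernelTriangle_outer hτ hhmin x)
    ((hi.mul_const _).const_mul _) (ae_weightLaw_gt.mono fun y hy => ?_)
  have hy0 := hhmin.trans hy
  simp only
  rw [← integral_const_mul, ← integral_const_mul]
  refine integral_mono_ae (integrable_kernelTriangle_inner hτ hhmin x y)
    ((hi.const_mul _).const_mul _) (ae_weightLaw_gt.mono fun z hz => ?_)
  have hz0 := hhmin.trans hz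
  have h := kernel_le_rpow hN hy0 hz0 hs0 hs1
  rw [Real.div_rpow (by positivity) hN.le, Real.mul_rpow hy0.le hz0.le, div_eq_mul_inv,
    ← Real.rpow_neg hN.le] at h
  calc _ ≤ kernel N x y * kernel N x z * (y ^ s * z ^ s * N ^ (-s)) :=
        mul_le_mul_of_nonneg_left h (mul_nonneg (kernel_nonneg _ _ _) (kernel_nonneg _ _ _))
    _ = _ := by ring

lemma kernelTriangle_le (hτ : 2 < τ) (hhmin : 0 < hmin) {s : ℝ} (hs : τ - 2 < s) (hs1 : s ≤ 1) :
    ∃ K > 0, ∀ N > 0, ∀ x > 0, kernelTriangle τ hmin N x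
      ≤ K * N ^ (s - 2 * (τ - 1)) * x ^ (2 * (τ - 1 - s)) := by
  obtain ⟨K, hK, h⟩ := integral_rpow_mul_kernel_le hτ hhmin hs (by linarith)
  refine ⟨K ^ 2, by positivity, fun N hN x hx => ?_⟩
  refine (kernelTriangle_le_sq hτ hhmin hN (by linarith) hs1 x).trans ?_
  have h1 := pow_le_pow_left₀ (integral_rpow_mul_kernel_nonneg hhmin s x) (h N hN x hx) 2
  refine (mul_le_mul_of_nonneg_left h1 (Real.rpow_nonneg hN.le _)).trans_eq ?_
  have e1 : ((x / N) ^ (τ - 1 - s)) ^ 2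
      = x ^ (2 * (τ - 1 - s)) * N ^ (-(2 * (τ - 1 - s))) := by
    rw [← Real.rpow_natCast, ← Real.rpow_mul (by positivity), Real.div_rpow hx.le hN.le,
      Real.rpow_neg hN.le, div_eq_mul_inv]
    push_cast
    ring_nf
  have e2 : N ^ (s - 2 * (τ - 1)) = N ^ (-s) * N ^ (-(2 * (τ - 1 - s))) := by
    rw [← Real.rpow_add hN]; ring_nf
  rw [mul_pow, e1, e2]
  ring

/-- Decoupling with `s = 1` and bounding the remaining kernel by 1 leaves the squared mean. Used for
weights above `N`, where the power bounds in `x` keep growing. -/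
lemma kernelTriangle_le_div (hτ : 2 < τ) (hhmin : 0 < hmin) :
    ∃ K > 0, ∀ N > 0, ∀ x, kernelTriangle τ hmin N x ≤ K * N ^ (-1 : ℝ) := by
  have hm : Integrable (fun y : ℝ => y ^ (1 : ℝ)) (weightLaw τ hmin) :=
    integrable_rpow_weightLaw hτ hhmin (by linarith)
  refine ⟨meanWeight τ hmin ^ 2, pow_pos (meanWeight_pos hτ hhmin) 2, fun N hN x => ?_⟩
  refine (kernelTriangle_le_sq hτ hhmin hN zero_le_one le_rfl x).trans ?_
  rw [mul_comm]
  refine mul_le_mul_of_nonneg_right (pow_le_pow_left₀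
    (integral_rpow_mul_kernel_nonneg hhmin 1 x) ?_ 2) (Real.rpow_nonneg hN.le _)
  have : meanWeight τ hmin = ∫ y, y ^ (1 : ℝ) ∂(weightLaw τ hmin) := by simp [meanWeight]
  rw [this]
  refine integral_mono_ae (integrable_rpow_mul_kernel hτ hhmin (by linarith) x) hm
    (ae_weightLaw_gt.mono fun y hy => ?_)
  exact mul_le_of_le_one_right (Real.rpow_nonneg (hhmin.trans hy).le _) (kernel_le_one _ _ _)

end Kernel

/-! ### Bounds for the triangle, bow-tie and diamond densities -/

section Densities

variable {τ hmin N : ℝ}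

lemma integrable_kernelTriangle_pow (hτ : 2 < τ) (hhmin : 0 < hmin) (p : ℕ) :
    Integrable (fun x => kernelTriangle τ hmin N x ^ p) (weightLaw τ hmin) := by
  have := isProbabilityMeasure_weightLaw hτ hhmin
  refine integrable_of_mem_Icc ((measurable_kernelTriangle hτ hhmin).pow_const p) fun x => ?_
  have h := kernelTriangle_mem_Icc (N := N) hτ hhmin x
  exact ⟨pow_nonneg h.1 _, pow_le_one₀ h.1 h.2⟩

lemma kernelTriangle_pow_le (hτ : 2 < τ) (hhmin : 0 < hmin) {s : ℝ} (hs : τ - 2 < s) (hs1 : s ≤ 1)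
    (p : ℕ) :
    ∃ K > 0, ∀ N > 0, ∀ x > 0, kernelTriangle τ hmin N x ^ p
      ≤ K * N ^ (p * (s - 2 * (τ - 1))) * x ^ (p * (2 * (τ - 1 - s))) := by
  obtain ⟨K, hK, h⟩ := kernelTriangle_le hτ hhmin hs hs1
  refine ⟨K ^ p, by positivity, fun N hN x hx => ?_⟩
  refine (pow_le_pow_left₀ (kernelTriangle_mem_Icc hτ hhmin x).1 (h N hN x hx) p).trans_eq ?_
  rw [mul_pow, mul_pow, ← Real.rpow_mul_natCast hN.le, ← Real.rpow_mul_natCast hx.le]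
  ring_nf

lemma rpow_sqrt_combine (hN : 0 < N) (a b : ℝ) :
    N ^ a * (N ^ (1 / 2 : ℝ)) ^ b = N ^ (a + b / 2) := by
  rw [← Real.rpow_mul hN.le, ← Real.rpow_add hN]
  ring_nf

/-- For small weights `s` is taken low enough that the resulting power of `x` exceeds `τ - 1`; the
integral is then governed by its end √N, and the exponent no longer depends on `s`. -/
lemma setIntegral_Iic_kernelTriangle_pow_le (hτ : 2 < τ) (hτ' : τ < 3) (hhmin : 0 < hmin) {p : ℕ}
    (hp : 1 ≤ p) :
    ∃ K > 0, ∀ N > 0, ∫ x in Set.Iic (N ^ (1 / 2 : ℝ)), kernelTriangle τ hmin N x ^ p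
      ∂(weightLaw τ hmin) ≤ K * N ^ (-((p + 1 / 2) * (τ - 1))) := by
  -- The midpoint of the admissible interval from τ-2 to (τ-1)/2, which is nonempty because τ < 3.
  obtain ⟨s, hs⟩ : ∃ s, s = (3 * τ - 5) / 4 := ⟨_, rfl⟩
  have hp' : (1 : ℝ) ≤ p := by exact_mod_cast hp
  obtain ⟨K₁, hK₁, h₁⟩ := kernelTriangle_pow_le hτ hhmin (s := s) (by linarith) (by linarith) p
  have ha : τ - 1 < p * (2 * (τ - 1 - s)) := by nlinarith
  obtain ⟨K₂, hK₂, h₂⟩ := setIntegral_Iic_rpow_le hτ hhmin ha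
  refine ⟨K₁ * K₂, by positivity, fun N hN => ?_⟩
  have ht : 0 < N ^ (1 / 2 : ℝ) := Real.rpow_pos_of_pos hN _
  calc _ ≤ ∫ x in Set.Iic (N ^ (1 / 2 : ℝ)), K₁ * N ^ (p * (s - 2 * (τ - 1)))
        * x ^ (p * (2 * (τ - 1 - s))) ∂(weightLaw τ hmin) :=
        setIntegral_mono_ae (integrable_kernelTriangle_pow hτ hhmin p).integrableOn
          ((integrableOn_Iic_rpow_weightLaw hτ hhmin ha ht.le).const_mul _)
          (ae_weightLaw_gt.mono fun x hx => h₁ N hN x (hhmin.trans hx))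
    _ = K₁ * N ^ (p * (s - 2 * (τ - 1))) * ∫ x in Set.Iic (N ^ (1 / 2 : ℝ)),
        x ^ (p * (2 * (τ - 1 - s))) ∂(weightLaw τ hmin) := integral_const_mul _ _
    _ ≤ K₁ * N ^ (p * (s - 2 * (τ - 1))) * (K₂ * (N ^ (1 / 2 : ℝ)) ^
        (p * (2 * (τ - 1 - s)) - (τ - 1))) :=
        mul_le_mul_of_nonneg_left (h₂ _ ht) (by positivity)
    _ = K₁ * K₂ * (N ^ (p * (s - 2 * (τ - 1))) * (N ^ (1 / 2 : ℝ)) ^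
        (p * (2 * (τ - 1 - s)) - (τ - 1))) := by ring
    _ = _ := by rw [rpow_sqrt_combine hN]; ring_nf

/-- Above √N the choice `s = 1` gives a power of `x` below `τ - 1`, again because τ < 3; so both
halves are governed by √N. -/
lemma integral_kernelTriangle_le (hτ : 2 < τ) (hτ' : τ < 3) (hhmin : 0 < hmin) :
    ∃ K > 0, ∀ N > 0, ∫ x, kernelTriangle τ hmin N x ∂(weightLaw τ hmin)
      ≤ K * N ^ (-(3 / 2 * (τ - 1))) := by
  obtain ⟨K₀, hK₀, h₀⟩ := setIntegral_Iic_kernelTriangle_pow_le hτ hτ' hhmin le_rfl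
  obtain ⟨K₁, hK₁, h₁⟩ := kernelTriangle_le hτ hhmin (s := 1) (by linarith) le_rfl
  have ha : 2 * (τ - 1 - 1) < τ - 1 := by linarith
  obtain ⟨K₂, hK₂, h₂⟩ := setIntegral_Ioi_rpow_le hτ hhmin ha
  refine ⟨K₀ + K₁ * K₂, by positivity, fun N hN => ?_⟩
  have ht : 0 < N ^ (1 / 2 : ℝ) := Real.rpow_pos_of_pos hN _
  have e₀ := h₀ N hN
  simp only [pow_one, Nat.cast_one] at e₀
  rw [show (1 : ℝ) + 1 / 2 = 3 / 2 by norm_num] at e₀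
  have e₁ : ∫ x in Set.Ioi (N ^ (1 / 2 : ℝ)), kernelTriangle τ hmin N x ∂(weightLaw τ hmin)
      ≤ K₁ * K₂ * N ^ (-(3 / 2 * (τ - 1))) := by
    calc _ ≤ ∫ x in Set.Ioi (N ^ (1 / 2 : ℝ)), K₁ * N ^ (1 - 2 * (τ - 1))
          * x ^ (2 * (τ - 1 - 1)) ∂(weightLaw τ hmin) :=
          setIntegral_mono_ae (integrable_kernelTriangle hτ hhmin).integrableOn
            ((integrable_rpow_weightLaw hτ hhmin ha).const_mul _).integrableOn
            (ae_weightLaw_gt.mono fun x hx => h₁ N hN x (hhmin.trans hx))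
      _ = K₁ * N ^ (1 - 2 * (τ - 1)) * ∫ x in Set.Ioi (N ^ (1 / 2 : ℝ)),
          x ^ (2 * (τ - 1 - 1)) ∂(weightLaw τ hmin) := integral_const_mul _ _
      _ ≤ K₁ * N ^ (1 - 2 * (τ - 1)) * (K₂ * (N ^ (1 / 2 : ℝ)) ^
          (2 * (τ - 1 - 1) - (τ - 1))) :=
          mul_le_mul_of_nonneg_left (h₂ _ ht) (by positivity)
      _ = K₁ * K₂ * (N ^ (1 - 2 * (τ - 1)) * (N ^ (1 / 2 : ℝ)) ^
          (2 * (τ - 1 - 1) - (τ - 1))) := by ring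
      _ = _ := by rw [rpow_sqrt_combine hN]; ring_nf
  rw [← integral_add_compl (measurableSet_Iic (a := N ^ (1 / 2 : ℝ)))
    (integrable_kernelTriangle hτ hhmin), Set.compl_Iic]
  linarith

lemma hmin_le_sqrt (hN : hmin ^ 2 ≤ N) : hmin ≤ N ^ (1 / 2 : ℝ) := by
  rw [← Real.sqrt_eq_rpow]
  exact Real.le_sqrt_of_sq_le hN

lemma sqrt_mul_sqrt (hN : 0 ≤ N) : N ^ (1 / 2 : ℝ) * N ^ (1 / 2 : ℝ) = N := by
  rw [← Real.sqrt_eq_rpow, Real.mul_self_sqrt hN]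

lemma sqrt_le_self (hN : 1 ≤ N) : N ^ (1 / 2 : ℝ) ≤ N := by
  simpa using Real.rpow_le_rpow_of_exponent_le hN (show (1 / 2 : ℝ) ≤ 1 by norm_num)

/-- The three terms come from weights below √N, between √N and N, and above N. The middle integral
is left unevaluated because its order changes at τ = 7/3. -/
lemma integral_kernelTriangle_sq_le (hτ : 2 < τ) (hτ' : τ < 3) (hhmin : 0 < hmin) :
    ∃ K > 0, ∀ N ≥ 1, hmin ^ 2 ≤ N →
      ∫ x, kernelTriangle τ hmin N x ^ 2 ∂(weightLaw τ hmin)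
        ≤ K * (N ^ (-(5 / 2 * (τ - 1))) + N ^ (2 - 4 * (τ - 1)) *
          (∫ x in (N ^ (1 / 2 : ℝ))..N, x ^ (3 * τ - 8)) + N ^ (-2 - (τ - 1))) := by
  obtain ⟨K₀, hK₀, h₀⟩ := setIntegral_Iic_kernelTriangle_pow_le hτ hτ' hhmin one_le_two
  obtain ⟨K₁, hK₁, h₁⟩ := kernelTriangle_pow_le hτ hhmin (s := 1) (by linarith) le_rfl 2
  obtain ⟨K₂, hK₂, h₂⟩ := kernelTriangle_le_div hτ hhmin
  have hC := densityConst_pos hτ hhmin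
  have hH : 0 < hmin ^ (τ - 1) := Real.rpow_pos_of_pos hhmin _
  refine ⟨K₀ + K₁ * densityConst τ hmin + K₂ ^ 2 * hmin ^ (τ - 1), by positivity,
    fun N hN1 hN2 => ?_⟩
  have hprob := isProbabilityMeasure_weightLaw hτ hhmin
  have hN : 0 < N := by linarith
  have ht : 0 < N ^ (1 / 2 : ℝ) := Real.rpow_pos_of_pos hN _
  have ht1 := hmin_le_sqrt hN2
  have ht2 := sqrt_le_self hN1
  have hi := integrable_kernelTriangle_pow (N := N) hτ hhmin 2
  have e₀ := h₀ N hN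
  rw [show ((2 : ℕ) : ℝ) + 1 / 2 = 5 / 2 by norm_num] at e₀
  have e₁ : ∫ x in Set.Ioc (N ^ (1 / 2 : ℝ)) N, kernelTriangle τ hmin N x ^ 2 ∂(weightLaw τ hmin)
      ≤ K₁ * densityConst τ hmin * (N ^ (2 - 4 * (τ - 1)) *
          (∫ x in (N ^ (1 / 2 : ℝ))..N, x ^ (3 * τ - 8))) := by
    calc _ ≤ ∫ x in Set.Ioc (N ^ (1 / 2 : ℝ)) N, K₁ * N ^ (((2 : ℕ) : ℝ) * (1 - 2 * (τ - 1)))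
          * x ^ (((2 : ℕ) : ℝ) * (2 * (τ - 1 - 1))) ∂(weightLaw τ hmin) :=
          setIntegral_mono_ae hi.integrableOn
            ((integrableOn_Ioc_rpow_weightLaw hτ hhmin _ ht _).const_mul _)
            (ae_weightLaw_gt.mono fun x hx => h₁ N hN x (hhmin.trans hx))
      _ = _ := by
          rw [integral_const_mul, setIntegral_Ioc_rpow hτ hhmin _ ht1 ht2,
            show ((2 : ℕ) : ℝ) * (2 * (τ - 1 - 1)) - τ = 3 * τ - 8 by push_cast; ring,
            show ((2 : ℕ) : ℝ) * (1 - 2 * (τ - 1)) = 2 - 4 * (τ - 1) by push_cast; ring]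
          ring
  have e₂ : ∫ x in Set.Ioi N, kernelTriangle τ hmin N x ^ 2 ∂(weightLaw τ hmin)
      ≤ K₂ ^ 2 * hmin ^ (τ - 1) * N ^ (-2 - (τ - 1)) := by
    calc _ ≤ ∫ x in Set.Ioi N, (K₂ * N ^ (-1 : ℝ)) ^ 2 ∂(weightLaw τ hmin) :=
          setIntegral_mono_ae hi.integrableOn (integrable_const _).integrableOn
            (ae_of_all _ fun x =>
              pow_le_pow_left₀ (kernelTriangle_mem_Icc hτ hhmin x).1 (h₂ N hN x) 2)
      _ = K₂ ^ 2 * hmin ^ (τ - 1) * ((N ^ (-1 : ℝ)) ^ 2 * N ^ (-(τ - 1))) := by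
          rw [setIntegral_const, measureReal_Ioi hτ hhmin (ht1.trans ht2),
            Real.div_rpow hhmin.le hN.le, smul_eq_mul, Real.rpow_neg hN.le (τ - 1)]
          ring
      _ = _ := by
          rw [← Real.rpow_mul_natCast hN.le, ← Real.rpow_add hN]
          push_cast
          ring_nf
  have hI : 0 ≤ ∫ x in (N ^ (1 / 2 : ℝ))..N, x ^ (3 * τ - 8) :=
    intervalIntegral.integral_nonneg ht2 fun x hx => Real.rpow_nonneg (ht.le.trans hx.1) _
  have hsplit : ∫ x, kernelTriangle τ hmin N x ^ 2 ∂(weightLaw τ hmin)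
      = (∫ x in Set.Iic (N ^ (1 / 2 : ℝ)), kernelTriangle τ hmin N x ^ 2 ∂(weightLaw τ hmin))
      + (∫ x in Set.Ioc (N ^ (1 / 2 : ℝ)) N, kernelTriangle τ hmin N x ^ 2 ∂(weightLaw τ hmin))
      + ∫ x in Set.Ioi N, kernelTriangle τ hmin N x ^ 2 ∂(weightLaw τ hmin) := by
    rw [← integral_add_compl (measurableSet_Iic (a := N ^ (1 / 2 : ℝ))) hi, Set.compl_Iic,
      ← Set.Ioc_union_Ioi_eq_Ioi ht2, setIntegral_union Set.Ioc_disjoint_Ioi_same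
        measurableSet_Ioi hi.integrableOn hi.integrableOn, add_assoc]
  rw [hsplit]
  have p₀ : 0 ≤ N ^ (-(5 / 2 * (τ - 1))) := Real.rpow_nonneg hN.le _
  have p₁ := mul_nonneg (Real.rpow_nonneg hN.le (2 - 4 * (τ - 1))) hI
  have p₂ : 0 ≤ N ^ (-2 - (τ - 1)) := Real.rpow_nonneg hN.le _
  generalize N ^ (2 - 4 * (τ - 1)) * (∫ x in (N ^ (1 / 2 : ℝ))..N, x ^ (3 * τ - 8)) = X₁ at *
  generalize N ^ (-(5 / 2 * (τ - 1))) = X₀ at *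
  generalize N ^ (-2 - (τ - 1)) = X₂ at *
  have c1 : 0 < K₁ * densityConst τ hmin := by positivity
  have c2 : 0 < K₂ ^ 2 * hmin ^ (τ - 1) := by positivity
  generalize K₁ * densityConst τ hmin = A at *
  generalize K₂ ^ 2 * hmin ^ (τ - 1) = B at *
  -- For nonnegative quantities, a sum of constants times terms is at most the sum of the constants
  -- times the sum of the terms.
  nlinarith [mul_nonneg hK₀.le p₁, mul_nonneg hK₀.le p₂, mul_nonneg c1.le p₀,
    mul_nonneg c1.le p₂, mul_nonneg c2.le p₀, mul_nonneg c2.le p₁]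

/-- Keep only the event that both other weights exceed `a`: the edges at `x` are then certain and
the third has probability at least `b`. -/
lemma le_kernelTriangle (hτ : 2 < τ) (hhmin : 0 < hmin) (hN : 0 < N) {x a b : ℝ} (hx : 0 < x)
    (ha : 0 < a) (hb : 0 ≤ b) (hb1 : b ≤ 1) (hxa : N ≤ x * a) (hab : b * N ≤ a * a) :
    b * (weightLaw τ hmin).real (Set.Ioi a) ^ 2 ≤ kernelTriangle τ hmin N x := by
  have := isProbabilityMeasure_weightLaw hτ hhmin
  let g : ℝ → ℝ := (Set.Ioi a).indicator fun _ => 1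
  have hg : Integrable g (weightLaw τ hmin) :=
    (integrable_const (1 : ℝ)).indicator measurableSet_Ioi
  have hgi : ∫ y, g y ∂(weightLaw τ hmin) = (weightLaw τ hmin).real (Set.Ioi a) := by
    simp only [g]
    rw [integral_indicator measurableSet_Ioi, setIntegral_const, smul_eq_mul, mul_one]
  have hk : ∀ y, a < y → 1 ≤ kernel N x y := fun y hy =>
    le_kernel (by rw [le_div_iff₀ hN, one_mul]; exact hxa.trans (by gcongr)) le_rfl
  rw [← hgi, pow_two, ← integral_mul_const, ← integral_const_mul]
  refine integral_mono (((hg.mul_const _)).const_mul _)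
    (integrable_kernelTriangle_outer hτ hhmin x) fun y => ?_
  simp only
  rw [← integral_const_mul, ← integral_const_mul]
  refine integral_mono ((hg.const_mul _).const_mul _)
    (integrable_kernelTriangle_inner hτ hhmin x y) fun z => ?_
  simp only [g]
  by_cases hy : y ∈ Set.Ioi a
  · by_cases hz : z ∈ Set.Ioi a
    · rw [Set.indicator_of_mem hy, Set.indicator_of_mem hz, one_mul, mul_one]
      have h3 : b ≤ kernel N y z := le_kernel (by
        rw [le_div_iff₀ hN]
        exact hab.trans (mul_le_mul (le_of_lt hy) (le_of_lt hz) ha.le (ha.le.trans (le_of_lt hy))))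
        hb1
      calc b = 1 * 1 * b := by ring
        _ ≤ _ := mul_le_mul (mul_le_mul (hk y hy) (hk z hz) zero_le_one (kernel_nonneg _ _ _)) h3 hb
            (mul_nonneg (kernel_nonneg _ _ _) (kernel_nonneg _ _ _))
    · rw [Set.indicator_of_notMem hz, mul_zero, mul_zero]
      exact (kernel_mul_mem_Icc x y z).1
  · rw [Set.indicator_of_notMem hy, zero_mul, mul_zero]
    exact (kernel_mul_mem_Icc x y z).1

/-- Three vertices of weight above √N certainly form a triangle, so the cube of the tail probability
is a lower bound. -/
lemma le_integral_kernelTriangle (hτ : 2 < τ) (hhmin : 0 < hmin) :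
    ∃ c > 0, ∀ N, hmin ^ 2 ≤ N →
      c * N ^ (-(3 / 2 * (τ - 1))) ≤ ∫ x, kernelTriangle τ hmin N x ∂(weightLaw τ hmin) := by
  refine ⟨(hmin ^ (τ - 1)) ^ 3, pow_pos (Real.rpow_pos_of_pos hhmin _) 3, fun N hN2 => ?_⟩
  have hprob := isProbabilityMeasure_weightLaw hτ hhmin
  have hN : 0 < N := (pow_pos hhmin 2).trans_le hN2
  have ht : 0 < N ^ (1 / 2 : ℝ) := Real.rpow_pos_of_pos hN _
  have hm := measureReal_Ioi hτ hhmin (hmin_le_sqrt hN2)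
  have hi := integrable_kernelTriangle (N := N) hτ hhmin
  calc (hmin ^ (τ - 1)) ^ 3 * N ^ (-(3 / 2 * (τ - 1)))
      = (weightLaw τ hmin).real (Set.Ioi (N ^ (1 / 2 : ℝ))) ^ 3 := by
        rw [hm, Real.div_rpow hhmin.le ht.le, div_pow, ← Real.rpow_mul hN.le,
          ← Real.rpow_mul_natCast hN.le, Real.rpow_neg hN.le, div_eq_mul_inv]
        push_cast
        ring_nf
    _ = ∫ x in Set.Ioi (N ^ (1 / 2 : ℝ)),
        1 * (weightLaw τ hmin).real (Set.Ioi (N ^ (1 / 2 : ℝ))) ^ 2 ∂(weightLaw τ hmin) := by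
        rw [setIntegral_const, smul_eq_mul]; ring
    _ ≤ ∫ x in Set.Ioi (N ^ (1 / 2 : ℝ)), kernelTriangle τ hmin N x ∂(weightLaw τ hmin) := by
        refine setIntegral_mono_on (integrable_const _).integrableOn hi.integrableOn
          measurableSet_Ioi fun x hx => ?_
        refine le_kernelTriangle hτ hhmin hN (ht.trans hx) ht zero_le_one le_rfl ?_ ?_
        · calc N = N ^ (1 / 2 : ℝ) * N ^ (1 / 2 : ℝ) := (sqrt_mul_sqrt hN.le).symm
            _ ≤ _ := mul_le_mul_of_nonneg_right (le_of_lt hx) ht.le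
        · rw [sqrt_mul_sqrt hN.le, one_mul]
    _ ≤ _ := setIntegral_le_integral hi
        (ae_of_all _ fun x => (kernelTriangle_mem_Icc hτ hhmin x).1)

lemma le_integral_kernelTriangle_sq (hτ : 2 < τ) (hhmin : 0 < hmin) :
    ∃ c > 0, ∀ N, hmin ^ 2 ≤ N →
      c * (N ^ (2 - 4 * (τ - 1)) * ∫ x in (N ^ (1 / 2 : ℝ))..(N / hmin), x ^ (3 * τ - 8))
        ≤ ∫ x, kernelTriangle τ hmin N x ^ 2 ∂(weightLaw τ hmin) := by
  have hC := densityConst_pos hτ hhmin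
  refine ⟨hmin ^ (4 * (τ - 1)) * densityConst τ hmin,
    mul_pos (Real.rpow_pos_of_pos hhmin _) hC, fun N hN2 => ?_⟩
  have hN : 0 < N := (pow_pos hhmin 2).trans_le hN2
  have ht : 0 < N ^ (1 / 2 : ℝ) := Real.rpow_pos_of_pos hN _
  have ht1 := hmin_le_sqrt hN2
  have ht2 : N ^ (1 / 2 : ℝ) ≤ N / hmin := by
    rw [le_div_iff₀ hhmin]
    exact (mul_le_mul_of_nonneg_left ht1 ht.le).trans_eq (sqrt_mul_sqrt hN.le)
  have hi := integrable_kernelTriangle_pow (N := N) hτ hhmin 2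
  calc _ = ∫ x in Set.Ioc (N ^ (1 / 2 : ℝ)) (N / hmin), hmin ^ (4 * (τ - 1)) *
        N ^ (2 - 4 * (τ - 1)) * x ^ (4 * (τ - 1) - 4) ∂(weightLaw τ hmin) := by
        rw [integral_const_mul, setIntegral_Ioc_rpow hτ hhmin _ ht1 ht2,
          show 4 * (τ - 1) - 4 - τ = 3 * τ - 8 by ring]
        ring
    _ ≤ ∫ x in Set.Ioc (N ^ (1 / 2 : ℝ)) (N / hmin), kernelTriangle τ hmin N x ^ 2
        ∂(weightLaw τ hmin) := by
        refine setIntegral_mono_on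
          ((integrableOn_Ioc_rpow_weightLaw hτ hhmin _ ht _).const_mul _) hi.integrableOn
          measurableSet_Ioc fun x hx => ?_
        have hx0 : 0 < x := ht.trans hx.1
        have ha : 0 < N / x := by positivity
        have hxN : N ≤ x * x := by
          rw [← sqrt_mul_sqrt hN.le]
          exact mul_le_mul hx.1.le hx.1.le ht.le hx0.le
        have hax : hmin ≤ N / x := by
          rw [le_div_iff₀ hx0, mul_comm, ← le_div_iff₀ hhmin]; exact hx.2
        -- `N / x` is the smallest weight surely joined to `x`, and two such weights have kernel `N
        -- / x ^ 2`. The bound `x ≤ N / hmin` makes the exact tail formula available at `N / x`.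
        have h := le_kernelTriangle hτ hhmin hN (x := x) (a := N / x) (b := N / (x * x)) hx0 ha
          (by positivity) ((div_le_one (by positivity)).2 hxN)
          (by rw [mul_div_cancel₀ _ hx0.ne']) (by
            apply le_of_eq; field_simp)
        rw [measureReal_Ioi hτ hhmin hax] at h
        refine le_trans (le_of_eq ?_) (pow_le_pow_left₀ (by positivity) h 2)
        have e1 : hmin / (N / x) = hmin * x * N ^ (-1 : ℝ) := by
          rw [Real.rpow_neg_one]; field_simp
        have e2 : N / (x * x) = N ^ (1 : ℝ) * x ^ (-2 : ℝ) := by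
          rw [Real.rpow_neg hx0.le, Real.rpow_one, div_eq_mul_inv]
          norm_num [pow_two]
        rw [e1, e2, Real.mul_rpow (by positivity) (by positivity),
          Real.mul_rpow hhmin.le hx0.le, ← Real.rpow_mul hN.le]
        simp only [mul_pow, ← Real.rpow_mul_natCast hN.le,
          ← Real.rpow_mul_natCast hx0.le, ← Real.rpow_mul_natCast hhmin.le]
        have eN : N ^ (2 - 4 * (τ - 1))
            = N ^ ((1 : ℝ) * (2 : ℕ)) * N ^ (-1 * (τ - 1) * ((2 : ℕ) : ℝ) * ((2 : ℕ) : ℝ)) := by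
          rw [← Real.rpow_add hN]; push_cast; ring_nf
        have ex : x ^ (4 * (τ - 1) - 4)
            = x ^ ((-2 : ℝ) * (2 : ℕ)) * x ^ ((τ - 1) * ((2 : ℕ) : ℝ) * ((2 : ℕ) : ℝ)) := by
          rw [← Real.rpow_add hx0]; push_cast; ring_nf
        have eh : hmin ^ (4 * (τ - 1)) = hmin ^ ((τ - 1) * ((2 : ℕ) : ℝ) * ((2 : ℕ) : ℝ)) := by
          push_cast; ring_nf
        rw [eN, ex, eh]
        ring
    _ ≤ _ := setIntegral_le_integral hi (ae_of_all _ fun x => sq_nonneg _)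

/-- Without the shared edge the diamond is a 4-cycle, in which every vertex has degree two. The
power bound with exponent `q / 2` on each edge therefore gives the product of the `h i ^ q`, which
factorises into moments. -/
lemma integral_diamond_le (hτ : 2 < τ) (hτ' : τ < 3) (hhmin : 0 < hmin) :
    ∃ K > 0, ∀ N > 0, ∫ h, kernel N (h 0) (h 1) * (kernel N (h 0) (h 2) * kernel N (h 1) (h 2) *
        kernel N (h 0) (h 3) * kernel N (h 1) (h 3))
        ∂(Measure.pi fun _ : Fin 4 => weightLaw τ hmin) ≤ K * N ^ (-((5 * τ - 7) / 2)) := by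
  have hprob := isProbabilityMeasure_weightLaw hτ hhmin
  -- Chosen so that N^(-2q) gives the diamond a relative contribution of n^((τ-3)/2); the moment is
  -- finite because q < τ-1 is equivalent to τ < 3.
  obtain ⟨q, hq⟩ : ∃ q, q = (5 * τ - 7) / 4 := ⟨_, rfl⟩
  have hqi := integrable_rpow_weightLaw hτ hhmin (a := q) (by linarith)
  have hnn : 0 ≤ ∫ x, x ^ q ∂(weightLaw τ hmin) := integral_nonneg_of_ae
    (ae_weightLaw_gt.mono fun x hx => Real.rpow_nonneg (hhmin.trans hx).le _)
  refine ⟨(∫ x, x ^ q ∂(weightLaw τ hmin)) ^ 4 + 1, by positivity, fun N hN => ?_⟩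
  have hae : ∀ᵐ h ∂(Measure.pi fun _ : Fin 4 => weightLaw τ hmin), ∀ i, hmin < h i :=
    ae_all_iff.2 fun i => (Measure.quasiMeasurePreserving_eval _ i).ae ae_weightLaw_gt
  have hint : Integrable (fun h : Fin 4 → ℝ => ∏ i, h i ^ q)
      (Measure.pi fun _ : Fin 4 => weightLaw τ hmin) :=
    Integrable.fintype_prod (f := fun _ x => x ^ q) fun _ => hqi
  have hk := kernel_nonneg N
  have hk1 := kernel_le_one N
  calc _ ≤ ∫ h, N ^ (-((5 * τ - 7) / 2)) * ∏ i, h i ^ q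
        ∂(Measure.pi fun _ : Fin 4 => weightLaw τ hmin) := by
        refine integral_mono_of_nonneg (ae_of_all _ fun h => ?_) (hint.const_mul _)
          (hae.mono fun h hh => ?_)
        · exact mul_nonneg (hk _ _) (mul_nonneg (mul_nonneg (mul_nonneg (hk _ _) (hk _ _))
            (hk _ _)) (hk _ _))
        · have h0 : ∀ i, 0 < h i := fun i => hhmin.trans (hh i)
          have hb : ∀ i j, kernel N (h i) (h j)
              ≤ h i ^ (q / 2) * h j ^ (q / 2) * N ^ (-(q / 2)) := by
            intro i j
            have := kernel_le_rpow hN (h0 i) (h0 j) (s := q / 2) (by linarith) (by linarith)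
            rwa [Real.div_rpow (mul_pos (h0 i) (h0 j)).le hN.le,
              Real.mul_rpow (h0 i).le (h0 j).le, div_eq_mul_inv, ← Real.rpow_neg hN.le] at this
          have hsq : ∀ i, h i ^ q = h i ^ (q / 2) * h i ^ (q / 2) := by
            intro i; rw [← Real.rpow_add (h0 i)]; ring_nf
          have hNq : N ^ (-((5 * τ - 7) / 2)) = N ^ (-(q / 2)) * N ^ (-(q / 2)) *
              N ^ (-(q / 2)) * N ^ (-(q / 2)) := by
            rw [← Real.rpow_add hN, ← Real.rpow_add hN, ← Real.rpow_add hN, hq]; ring_nf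
          have hp : ∀ i j, 0 ≤ h i ^ (q / 2) * h j ^ (q / 2) * N ^ (-(q / 2)) :=
            fun i j => (hk _ _).trans (hb i j)
          simp only [Fin.prod_univ_four, hsq, hNq]
          calc _ ≤ kernel N (h 0) (h 2) * kernel N (h 1) (h 2) *
                kernel N (h 0) (h 3) * kernel N (h 1) (h 3) :=
                mul_le_of_le_one_left (mul_nonneg (mul_nonneg (mul_nonneg (hk _ _) (hk _ _))
                  (hk _ _)) (hk _ _)) (hk1 _ _)
            _ ≤ _ := mul_le_mul (mul_le_mul (mul_le_mul (hb 0 2) (hb 1 2) (hk _ _) (hp _ _))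
                (hb 0 3) (hk _ _) (mul_nonneg (hp _ _) (hp _ _))) (hb 1 3) (hk _ _)
                (mul_nonneg (mul_nonneg (hp _ _) (hp _ _)) (hp _ _))
            _ = _ := by ring
    _ = (∫ x, x ^ q ∂(weightLaw τ hmin)) ^ 4 * N ^ (-((5 * τ - 7) / 2)) := by
        rw [integral_const_mul, integral_fintype_prod_eq_prod (fun _ x => x ^ q)]
        simp [mul_comm]
    _ ≤ _ := mul_le_mul_of_nonneg_right (by linarith) (Real.rpow_nonneg hN.le _)

end Densities

/-! ### Orders of growth in a real parameter -/

section RealAsymptotics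

variable {τ hmin : ℝ}

lemma isBigO_rpow_rpow {a b : ℝ} (hab : a ≤ b) :
    (fun x : ℝ => x ^ a) =O[atTop] fun x : ℝ => x ^ b := by
  refine IsBigO.of_bound 1 ((eventually_ge_atTop 1).mono fun x hx => ?_)
  have h0 : 0 ≤ x := zero_le_one.trans hx
  rw [one_mul, Real.norm_of_nonneg (Real.rpow_nonneg h0 _),
    Real.norm_of_nonneg (Real.rpow_nonneg h0 _)]
  exact Real.rpow_le_rpow_of_exponent_le hx hab

lemma isLittleO_rpow_rpow {a b : ℝ} (hab : a < b) :
    (fun x : ℝ => x ^ a) =o[atTop] fun x : ℝ => x ^ b := by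
  refine (isLittleO_iff_tendsto' ((eventually_gt_atTop 0).mono fun x hx h =>
    absurd h (Real.rpow_pos_of_pos hx _).ne')).2 ?_
  refine (tendsto_rpow_neg_atTop (sub_pos.2 hab)).congr'
    ((eventually_gt_atTop 0).mono fun x hx => ?_)
  show x ^ (-(b - a)) = x ^ a / x ^ b
  rw [← Real.rpow_sub hx, neg_sub]

lemma eventually_sqrt_le_div {h : ℝ} (hh : 0 < h) :
    ∀ᶠ N : ℝ in atTop, 0 < N ^ (1 / 2 : ℝ) ∧ N ^ (1 / 2 : ℝ) ≤ N / h := by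
  filter_upwards [eventually_gt_atTop 0, eventually_ge_atTop (h ^ 2)] with N hN hN2
  have ht := Real.rpow_pos_of_pos hN (1 / 2)
  refine ⟨ht, ?_⟩
  rw [le_div_iff₀ hh]
  exact (mul_le_mul_of_nonneg_left (hmin_le_sqrt hN2) ht.le).trans_eq (sqrt_mul_sqrt hN.le)

/-- The two endpoint contributions are kept apart: the sign of `q + 1` decides which one dominates.
-/
lemma integral_rpow_eventuallyEq {h : ℝ} (hh : 0 < h) {q : ℝ} (hq : q ≠ -1) :
    (fun N : ℝ => ∫ x in (N ^ (1 / 2 : ℝ))..(N / h), x ^ q) =ᶠ[atTop]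
      fun N => (h ^ (q + 1))⁻¹ / (q + 1) * N ^ (q + 1) + -(1 / (q + 1)) * N ^ ((q + 1) / 2) := by
  filter_upwards [eventually_sqrt_le_div hh, eventually_gt_atTop 0] with N hN hN0
  rw [integral_rpow (Or.inr ⟨hq, Set.notMem_uIcc_of_lt hN.1 (hN.1.trans_le hN.2)⟩),
    Real.div_rpow hN0.le hh.le, ← Real.rpow_mul hN0.le]
  rw [show 1 / 2 * (q + 1) = (q + 1) / 2 by ring]
  ring

lemma isTheta_integral_rpow_of_lt {h : ℝ} (hh : 0 < h) {q : ℝ} (hq : q < -1) :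
    (fun N : ℝ => ∫ x in (N ^ (1 / 2 : ℝ))..(N / h), x ^ q) =Θ[atTop]
      fun N => N ^ ((q + 1) / 2) := by
  refine (integral_rpow_eventuallyEq hh hq.ne).trans_isTheta (IsLittleO.add_isTheta ?_ ?_)
  · exact (isLittleO_rpow_rpow (by linarith)).const_mul_left _
  · exact (isTheta_refl _ _).const_mul_left
      (neg_ne_zero.2 (one_div_ne_zero (by linarith : q + 1 < 0).ne))

lemma isTheta_integral_rpow_of_gt {h : ℝ} (hh : 0 < h) {q : ℝ} (hq : -1 < q) :
    (fun N : ℝ => ∫ x in (N ^ (1 / 2 : ℝ))..(N / h), x ^ q) =Θ[atTop]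
      fun N => N ^ (q + 1) := by
  refine (integral_rpow_eventuallyEq hh hq.ne').trans_isTheta (IsTheta.add_isLittleO ?_ ?_)
  · exact (isTheta_refl _ _).const_mul_left (div_ne_zero
      (inv_ne_zero (Real.rpow_pos_of_pos hh _).ne') (by linarith : 0 < q + 1).ne')
  · exact (isLittleO_rpow_rpow (by linarith)).const_mul_left _

lemma isTheta_integral_rpow_neg_one {h : ℝ} (hh : 0 < h) :
    (fun N : ℝ => ∫ x in (N ^ (1 / 2 : ℝ))..(N / h), x ^ (-1 : ℝ)) =Θ[atTop] Real.log := by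
  have h1 : (fun N : ℝ => ∫ x in (N ^ (1 / 2 : ℝ))..(N / h), x ^ (-1 : ℝ)) =ᶠ[atTop]
      fun N => 1 / 2 * Real.log N + -Real.log h := by
    filter_upwards [eventually_sqrt_le_div hh, eventually_gt_atTop 0] with N hN hN0
    simp_rw [Real.rpow_neg_one]
    rw [integral_inv_of_pos hN.1 (hN.1.trans_le hN.2),
      Real.log_div (div_pos hN0 hh).ne' hN.1.ne', Real.log_div hN0.ne' hh.ne',
      Real.log_rpow hN0]
    ring
  refine h1.trans_isTheta (IsTheta.add_isLittleO ?_ ?_)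
  · exact (isTheta_refl _ _).const_mul_left (by norm_num)
  · exact isLittleO_const_left.2 (Or.inr (tendsto_norm_atTop_atTop.comp Real.tendsto_log_atTop))

lemma isBigO_log_mul {f : ℝ → ℝ} : f =O[atTop] fun x => f x * Real.log x := by
  refine IsBigO.of_bound 1 ?_
  filter_upwards [Real.tendsto_log_atTop.eventually_ge_atTop 1] with x hx
  rw [one_mul, norm_mul, Real.norm_of_nonneg (zero_le_one.trans hx)]
  exact le_mul_of_one_le_right (norm_nonneg _) hx

lemma isTheta_integral_kernelTriangle (hτ : 2 < τ) (hτ' : τ < 3) (hhmin : 0 < hmin) :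
    (fun N : ℝ => ∫ x, kernelTriangle τ hmin N x ∂(weightLaw τ hmin)) =Θ[atTop]
      fun N => N ^ (-(3 / 2 * (τ - 1))) := by
  obtain ⟨K, hK, h⟩ := integral_kernelTriangle_le hτ hτ' hhmin
  obtain ⟨c, hc, h'⟩ := le_integral_kernelTriangle hτ hhmin
  have hnn : ∀ N, 0 ≤ ∫ x, kernelTriangle τ hmin N x ∂(weightLaw τ hmin) := fun N =>
    integral_nonneg fun x => (kernelTriangle_mem_Icc hτ hhmin x).1
  constructor
  · refine IsBigO.of_bound K ((eventually_gt_atTop 0).mono fun N hN => ?_)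
    rw [Real.norm_of_nonneg (hnn N), Real.norm_of_nonneg (Real.rpow_nonneg hN.le _)]
    exact h N hN
  · refine IsBigO.of_bound c⁻¹ ?_
    filter_upwards [eventually_gt_atTop 0, eventually_ge_atTop (hmin ^ 2)] with N hN hN2
    rw [Real.norm_of_nonneg (hnn N), Real.norm_of_nonneg (Real.rpow_nonneg hN.le _),
      inv_mul_eq_div, le_div_iff₀ hc, mul_comm]
    exact h' N hN2

/-- `G` is the order of the final ratio, and N^(4-3τ) is the factor that the normalisation
n⁵/n^(9-3τ) cancels. `hG` is required for every cut-off `h` because the upper bound integrates to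
`N` and the lower one to `N / hmin`; `hG₁` and `hG₂` absorb the weights below √N and above N. -/
lemma isTheta_integral_kernelTriangle_sq (hτ : 2 < τ) (hτ' : τ < 3) (hhmin : 0 < hmin)
    {G : ℝ → ℝ}
    (hG : ∀ h > 0, (fun N : ℝ => N ^ (2 - τ) * ∫ x in (N ^ (1 / 2 : ℝ))..(N / h), x ^ (3 * τ - 8))
      =Θ[atTop] G)
    (hG₁ : (fun N : ℝ => N ^ ((τ - 3) / 2)) =O[atTop] G)
    (hG₂ : (fun N : ℝ => N ^ (2 * τ - 5)) =O[atTop] G) :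
    (fun N : ℝ => ∫ x, kernelTriangle τ hmin N x ^ 2 ∂(weightLaw τ hmin)) =Θ[atTop]
      fun N => N ^ (4 - 3 * τ) * G N := by
  obtain ⟨K, hK, hup⟩ := integral_kernelTriangle_sq_le hτ hτ' hhmin
  obtain ⟨c, hc, hlow⟩ := le_integral_kernelTriangle_sq hτ hhmin
  have hnn : ∀ N, 0 ≤ ∫ x, kernelTriangle τ hmin N x ^ 2 ∂(weightLaw τ hmin) := fun N =>
    integral_nonneg fun x => sq_nonneg _
  have hprod : ∀ h, (fun N : ℝ => N ^ (2 - 4 * (τ - 1)) *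
      ∫ x in (N ^ (1 / 2 : ℝ))..(N / h), x ^ (3 * τ - 8)) =ᶠ[atTop]
      fun N => N ^ (4 - 3 * τ) * (N ^ (2 - τ) *
        ∫ x in (N ^ (1 / 2 : ℝ))..(N / h), x ^ (3 * τ - 8)) := fun h =>
    (eventually_gt_atTop 0).mono fun N hN => by
      simp only
      rw [← mul_assoc, ← Real.rpow_add hN]
      ring_nf
  have hpow : ∀ a b : ℝ, a = 4 - 3 * τ + b → (fun N : ℝ => N ^ b) =O[atTop] G →
      (fun N : ℝ => N ^ a) =O[atTop] fun N => N ^ (4 - 3 * τ) * G N := by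
    intro a b hab hb
    refine (EventuallyEq.trans_isBigO ?_ ((isBigO_refl (fun N : ℝ => N ^ (4 - 3 * τ)) _).mul hb))
    filter_upwards [eventually_gt_atTop 0] with N hN
    rw [← Real.rpow_add hN, hab]
  constructor
  · have h1 : (fun N : ℝ => ∫ x, kernelTriangle τ hmin N x ^ 2 ∂(weightLaw τ hmin)) =O[atTop]
        fun N : ℝ => N ^ (-(5 / 2 * (τ - 1))) + N ^ (2 - 4 * (τ - 1)) *
          (∫ x in (N ^ (1 / 2 : ℝ))..(N / 1), x ^ (3 * τ - 8)) + N ^ (-2 - (τ - 1)) := by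
      refine IsBigO.of_bound K ?_
      filter_upwards [eventually_ge_atTop 1, eventually_ge_atTop (hmin ^ 2)] with N hN hN2
      rw [Real.norm_of_nonneg (hnn N), div_one]
      exact (hup N hN hN2).trans (mul_le_mul_of_nonneg_left (Real.le_norm_self _) hK.le)
    refine h1.trans ((IsBigO.add (hpow _ _ (by ring) hG₁) ?_).add (hpow _ _ (by ring) hG₂))
    exact (hprod 1).trans_isBigO ((isBigO_refl _ _).mul (hG 1 one_pos).1)
  · refine IsBigO.trans (((isBigO_refl _ _).mul (hG hmin hhmin).2).trans_eventuallyEq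
      (hprod hmin).symm) ?_
    refine IsBigO.of_bound c⁻¹ ?_
    filter_upwards [eventually_ge_atTop (hmin ^ 2), eventually_sqrt_le_div hhmin,
      eventually_gt_atTop 0] with N hN2 hN hN0
    have hI : 0 ≤ ∫ x in (N ^ (1 / 2 : ℝ))..(N / hmin), x ^ (3 * τ - 8) :=
      intervalIntegral.integral_nonneg hN.2 fun x hx => Real.rpow_nonneg (hN.1.le.trans hx.1) _
    rw [Real.norm_of_nonneg (hnn N),
      Real.norm_of_nonneg (mul_nonneg (Real.rpow_nonneg hN0.le _) hI),
      inv_mul_eq_div, le_div_iff₀ hc, mul_comm]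
    exact hlow N hN2

lemma isTheta_rpow_mul {f : ℝ → ℝ} {a b d : ℝ} (hf : f =Θ[atTop] fun N => N ^ b)
    (hd : a + b = d) : (fun N => N ^ a * f N) =Θ[atTop] fun N => N ^ d := by
  refine (((isTheta_refl (fun N : ℝ => N ^ a) _).mul hf)).trans_eventuallyEq ?_
  filter_upwards [eventually_gt_atTop 0] with N hN
  rw [← Real.rpow_add hN, hd]

lemma isTheta_integral_kernelTriangle_sq_of_lt (hτ : 2 < τ) (hτ' : τ < 7 / 3)
    (hhmin : 0 < hmin) :
    (fun N : ℝ => ∫ x, kernelTriangle τ hmin N x ^ 2 ∂(weightLaw τ hmin)) =Θ[atTop]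
      fun N => N ^ (4 - 3 * τ) * N ^ ((τ - 3) / 2) := by
  refine isTheta_integral_kernelTriangle_sq hτ (by linarith) hhmin (fun h hh => ?_)
    (isBigO_refl _ _) (isBigO_rpow_rpow (by linarith))
  exact isTheta_rpow_mul (isTheta_integral_rpow_of_lt hh (by linarith)) (by ring)

lemma isTheta_integral_kernelTriangle_sq_of_gt (hτ : 7 / 3 < τ) (hτ' : τ < 3)
    (hhmin : 0 < hmin) :
    (fun N : ℝ => ∫ x, kernelTriangle τ hmin N x ^ 2 ∂(weightLaw τ hmin)) =Θ[atTop]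
      fun N => N ^ (4 - 3 * τ) * N ^ (2 * τ - 5) := by
  refine isTheta_integral_kernelTriangle_sq (by linarith) hτ' hhmin (fun h hh => ?_)
    (isBigO_rpow_rpow (by linarith)) (isBigO_refl _ _)
  exact isTheta_rpow_mul (isTheta_integral_rpow_of_gt hh (by linarith)) (by ring)

lemma isTheta_integral_kernelTriangle_sq_of_eq (hτ : τ = 7 / 3) (hhmin : 0 < hmin) :
    (fun N : ℝ => ∫ x, kernelTriangle τ hmin N x ^ 2 ∂(weightLaw τ hmin)) =Θ[atTop]
      fun N => N ^ (4 - 3 * τ) * (N ^ (2 * τ - 5) * Real.log N) := by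
  refine isTheta_integral_kernelTriangle_sq (by linarith) (by linarith) hhmin (fun h hh => ?_)
    ((isBigO_rpow_rpow (by linarith)).trans isBigO_log_mul) isBigO_log_mul
  rw [show 3 * τ - 8 = -1 by linarith, show 2 - τ = 2 * τ - 5 by linarith]
  exact (isTheta_refl _ _).mul (isTheta_integral_rpow_neg_one hh)

end RealAsymptotics

/-! ### Passage to the number of vertices and the relative fluctuation -/

section Sequences

variable {τ hmin : ℝ} {m : ℝ}

lemma tendsto_const_mul_natCast (hm : 0 < m) :
    Tendsto (fun n : ℕ => m * (n : ℝ)) atTop atTop :=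
  tendsto_natCast_atTop_atTop.const_mul_atTop hm

lemma isTheta_comp_const_mul {f g : ℝ → ℝ} (hm : 0 < m) (h : f =Θ[atTop] g) :
    (fun n : ℕ => f (m * n)) =Θ[atTop] fun n : ℕ => g (m * n) :=
  ⟨h.1.comp_tendsto (tendsto_const_mul_natCast hm),
    h.2.comp_tendsto (tendsto_const_mul_natCast hm)⟩

lemma isTheta_const_mul_rpow (hm : 0 < m) (a : ℝ) :
    (fun n : ℕ => (m * (n : ℝ)) ^ a) =Θ[atTop] fun n : ℕ => (n : ℝ) ^ a := by
  simp_rw [Real.mul_rpow hm.le (Nat.cast_nonneg _)]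
  exact (isTheta_refl _ _).const_mul_left (Real.rpow_pos_of_pos hm a).ne'

lemma isTheta_log_const_mul (hm : 0 < m) :
    (fun n : ℕ => Real.log (m * n)) =Θ[atTop] fun n : ℕ => Real.log n := by
  have h1 : (fun n : ℕ => Real.log (m * n)) =ᶠ[atTop] fun n : ℕ => Real.log m + Real.log n := by
    filter_upwards [eventually_gt_atTop 0] with n hn
    rw [Real.log_mul hm.ne' (by positivity)]
  refine h1.trans_isTheta (IsLittleO.add_isTheta ?_ (isTheta_refl _ _))
  exact isLittleO_const_left.2 (Or.inr (tendsto_norm_atTop_atTop.comp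
    (Real.tendsto_log_atTop.comp tendsto_natCast_atTop_atTop)))

lemma isTheta_descFactorial (k : ℕ) :
    (fun n : ℕ => (n.descFactorial k : ℝ)) =Θ[atTop] fun n : ℕ => (n : ℝ) ^ (k : ℝ) := by
  simp_rw [Real.rpow_natCast]
  constructor
  · refine IsBigO.of_bound 1 (Eventually.of_forall fun n => ?_)
    rw [one_mul, Real.norm_of_nonneg (by positivity), Real.norm_of_nonneg (by positivity)]
    exact_mod_cast Nat.descFactorial_le_pow n k
  -- For `n ≥ 2 * k` each of the `k` factors of the falling factorial is at least `n / 2`.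
  · refine IsBigO.of_bound (2 ^ k) ((eventually_ge_atTop (2 * k)).mono fun n hn => ?_)
    rw [Real.norm_of_nonneg (by positivity), Real.norm_of_nonneg (by positivity)]
    have h : n ^ k ≤ 2 ^ k * n.descFactorial k :=
      calc n ^ k ≤ (2 * (n + 1 - k)) ^ k := Nat.pow_le_pow_left (by omega) k
        _ = 2 ^ k * (n + 1 - k) ^ k := mul_pow _ _ _
        _ ≤ _ := Nat.mul_le_mul_left _ (Nat.pow_sub_le_descFactorial n k)
    exact_mod_cast h

lemma isBigO_natCast_rpow {a b : ℝ} (hab : a ≤ b) :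
    (fun n : ℕ => (n : ℝ) ^ a) =O[atTop] fun n : ℕ => (n : ℝ) ^ b :=
  (isBigO_rpow_rpow hab).comp_tendsto tendsto_natCast_atTop_atTop

lemma isLittleO_natCast_rpow {a b : ℝ} (hab : a < b) :
    (fun n : ℕ => (n : ℝ) ^ a) =o[atTop] fun n : ℕ => (n : ℝ) ^ b :=
  (isLittleO_rpow_rpow hab).comp_tendsto tendsto_natCast_atTop_atTop

lemma natCast_rpow_mul (a b : ℝ) :
    (fun n : ℕ => (n : ℝ) ^ a * (n : ℝ) ^ b) =ᶠ[atTop] fun n : ℕ => (n : ℝ) ^ (a + b) :=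
  (eventually_gt_atTop 0).mono fun _ hn =>
    (Real.rpow_add (Nat.cast_pos.2 hn) a b).symm

lemma isTheta_patternDensity_triangle (hτ : 2 < τ) (hτ' : τ < 3) (hhmin : 0 < hmin) :
    (fun n : ℕ => patternDensity τ hmin n triangleEdges) =Θ[atTop]
      fun n : ℕ => (n : ℝ) ^ (-(3 / 2 * (τ - 1))) := by
  have hm := meanWeight_pos hτ hhmin
  simp_rw [patternDensity_triangle hτ hhmin]
  -- `triangleProb τ hmin n` is by definition `kernelTriangle` at `N = meanWeight τ hmin * n`.
  exact (isTheta_comp_const_mul hm (isTheta_integral_kernelTriangle hτ hτ' hhmin)).trans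
    (isTheta_const_mul_rpow hm _)

lemma isBigO_patternDensity_diamond (hτ : 2 < τ) (hτ' : τ < 3) (hhmin : 0 < hmin) :
    (fun n : ℕ => patternDensity τ hmin n diamondEdges) =O[atTop]
      fun n : ℕ => (n : ℝ) ^ (-((5 * τ - 7) / 2)) := by
  have hm := meanWeight_pos hτ hhmin
  obtain ⟨K, hK, h⟩ := integral_diamond_le hτ hτ' hhmin
  refine IsBigO.trans ?_ (isTheta_const_mul_rpow hm _).1
  refine IsBigO.of_bound K ((eventually_gt_atTop 0).mono fun n hn => ?_)
  have hN : 0 < meanWeight τ hmin * n := mul_pos hm (Nat.cast_pos.2 hn)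
  have hnn : 0 ≤ patternDensity τ hmin n diamondEdges :=
    integral_nonneg fun h => (prod_threshold_mem_Icc _ h).1
  rw [Real.norm_of_nonneg hnn, Real.norm_of_nonneg (Real.rpow_nonneg hN.le _),
    patternDensity_diamond]
  exact h _ hN

lemma expect_triangle (hτ : 2 < τ) (hhmin : 0 < hmin) (n : ℕ) :
    expect τ hmin n (motifCount triangle)
      = n.descFactorial 3 * patternDensity τ hmin n triangleEdges := by
  rw [triangle_eq, expect_motifCount hτ hhmin triangleEdges_not_isDiag]

lemma expect_bowTie (hτ : 2 < τ) (hhmin : 0 < hmin) (n : ℕ) :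
    expect τ hmin n (motifCount bowTie)
      = n.descFactorial 5 * patternDensity τ hmin n bowTieEdges := by
  rw [bowTie_eq, expect_motifCount hτ hhmin bowTieEdges_not_isDiag]

lemma expect_diamond (hτ : 2 < τ) (hhmin : 0 < hmin) (n : ℕ) :
    expect τ hmin n (motifCount diamond)
      = n.descFactorial 4 * patternDensity τ hmin n diamondEdges := by
  rw [diamond_eq, expect_motifCount hτ hhmin diamondEdges_not_isDiag]

lemma isTheta_expect_triangle (hτ : 2 < τ) (hτ' : τ < 3) (hhmin : 0 < hmin) :
    (fun n : ℕ => expect τ hmin n (motifCount triangle)) =Θ[atTop]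
      fun n : ℕ => (n : ℝ) ^ ((9 - 3 * τ) / 2) := by
  simp_rw [expect_triangle hτ hhmin]
  refine ((isTheta_descFactorial 3).mul
    (isTheta_patternDensity_triangle hτ hτ' hhmin)).trans_eventuallyEq ?_
  refine (natCast_rpow_mul _ _).trans (EventuallyEq.of_eq ?_)
  push_cast
  ring_nf

lemma isTheta_expect_triangle_sq (hτ : 2 < τ) (hτ' : τ < 3) (hhmin : 0 < hmin) :
    (fun n : ℕ => expect τ hmin n (motifCount triangle) ^ 2) =Θ[atTop]
      fun n : ℕ => (n : ℝ) ^ (9 - 3 * τ) := by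
  refine ((isTheta_expect_triangle hτ hτ' hhmin).pow 2).trans_eventuallyEq
    (EventuallyEq.of_eq (funext fun n => ?_))
  rw [← Real.rpow_mul_natCast (Nat.cast_nonneg n)]
  push_cast
  ring_nf

/-- The part of the variance of the number of labelled triangles that comes from the square of
the mean. -/
noncomputable def varianceDefect (τ hmin : ℝ) (n : ℕ) : ℝ :=
  (9 * n.descFactorial 5 + 18 * n.descFactorial 4 + 6 * n.descFactorial 3)
    * patternDensity τ hmin n triangleEdges ^ 2

lemma isBigO_varianceDefect (hτ : 2 < τ) (hτ' : τ < 3) (hhmin : 0 < hmin) :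
    (fun n : ℕ => varianceDefect τ hmin n) =O[atTop] fun n : ℕ => (n : ℝ) ^ (8 - 3 * τ) := by
  have hd : ∀ k : ℕ, k ≤ 5 → ∀ c : ℝ, (fun n : ℕ => c * (n.descFactorial k : ℝ)) =O[atTop]
      fun n : ℕ => (n : ℝ) ^ (5 : ℝ) := fun k hk c =>
    ((isTheta_descFactorial k).1.trans (isBigO_natCast_rpow (by exact_mod_cast hk))).const_mul_left c
  have h1 := ((hd 5 le_rfl 9).add (hd 4 (by norm_num) 18)).add (hd 3 (by norm_num) 6)
  refine (h1.mul ((isTheta_patternDensity_triangle hτ hτ' hhmin).1.pow 2)).trans_eventuallyEq ?_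
  have h2 : ∀ n : ℕ, ((n : ℝ) ^ (-(3 / 2 * (τ - 1)))) ^ 2 = (n : ℝ) ^ (3 - 3 * τ) := fun n => by
    rw [← Real.rpow_mul_natCast (Nat.cast_nonneg n)]
    push_cast
    ring_nf
  simp_rw [h2]
  refine (natCast_rpow_mul _ _).trans (EventuallyEq.of_eq ?_)
  ring_nf

/-- The difference is exactly minus `varianceDefect`, of order at most n^(8-3τ), while the squared
mean has order n^(9-3τ). -/
lemma isBigO_var_sub (hτ : 2 < τ) (hτ' : τ < 3) (hhmin : 0 < hmin) :
    (fun n : ℕ => var τ hmin n (motifCount triangle)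
      - (9 * expect τ hmin n (motifCount bowTie) + 18 * expect τ hmin n (motifCount diamond)
        + 6 * expect τ hmin n (motifCount triangle))) =O[atTop]
      fun n : ℕ => (n : ℝ)⁻¹ * expect τ hmin n (motifCount triangle) ^ 2 := by
  have h1 : ∀ n : ℕ, var τ hmin n (motifCount triangle)
      - (9 * expect τ hmin n (motifCount bowTie) + 18 * expect τ hmin n (motifCount diamond)
        + 6 * expect τ hmin n (motifCount triangle)) = -varianceDefect τ hmin n := fun n => by
    rw [var_motifCount_triangle hτ hhmin, varianceDefect]; ring
  simp_rw [h1, ← Real.rpow_neg_one]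
  refine (isBigO_varianceDefect hτ hτ' hhmin).neg_left.trans ?_
  refine IsBigO.trans (EventuallyEq.isBigO ?_)
    ((isBigO_refl _ _).mul (isTheta_expect_triangle_sq hτ hτ' hhmin).2)
  refine EventuallyEq.symm ((natCast_rpow_mul _ _).trans (EventuallyEq.of_eq ?_))
  ring_nf

lemma relFluct_eq (τ hmin : ℝ) (n : ℕ) :
    relFluct τ hmin n
      = var τ hmin n (motifCount triangle) / expect τ hmin n (motifCount triangle) ^ 2 := by
  have hN : (motifCount triangle : SimpleGraph (Fin n) → ℝ) = fun G => 6 * triangleCount G :=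
    funext fun G => motifCount_triangle G
  rw [hN, var_const_mul, expect_const_mul, mul_pow, mul_div_mul_left _ _ (by norm_num), relFluct]

lemma expect_motifCount_nonneg (n : ℕ) {k : ℕ} (H : SimpleGraph (Fin k)) :
    0 ≤ expect τ hmin n (motifCount H) :=
  integral_nonneg fun _ => Nat.cast_nonneg _

/-- The bow-tie term has exact order `g`. Relative to the squared mean, the diamond is
O(n^((τ-3)/2)), the triangle term is of order n^(3(τ-3)/2) and the defect is O(n⁻¹); `hg'` makes all
three admissible. -/
lemma isTheta_relFluct (hτ : 2 < τ) (hτ' : τ < 3) (hhmin : 0 < hmin) {G : ℝ → ℝ} {g : ℕ → ℝ}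
    (hG : (fun N : ℝ => ∫ x, kernelTriangle τ hmin N x ^ 2 ∂(weightLaw τ hmin)) =Θ[atTop]
      fun N => N ^ (4 - 3 * τ) * G N)
    (hg : (fun n : ℕ => G (meanWeight τ hmin * n)) =Θ[atTop] g)
    (hg' : (fun n : ℕ => (n : ℝ) ^ ((τ - 3) / 2)) =O[atTop] g) :
    (fun n : ℕ => relFluct τ hmin n) =Θ[atTop] g := by
  have hm := meanWeight_pos hτ hhmin
  have hsq := isTheta_expect_triangle_sq hτ hτ' hhmin
  have hbt : (fun n : ℕ => 9 * expect τ hmin n (motifCount bowTie)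
      / expect τ hmin n (motifCount triangle) ^ 2) =Θ[atTop] g := by
    simp_rw [expect_bowTie hτ hhmin, patternDensity_bowTie hτ hhmin]
    have h1 := (isTheta_descFactorial 5).mul ((isTheta_comp_const_mul hm hG).trans
      ((isTheta_const_mul_rpow hm (4 - 3 * τ)).mul hg))
    refine ((h1.const_mul_left (c := 9) (by norm_num)).div hsq).trans_eventuallyEq ?_
    filter_upwards [eventually_gt_atTop 0] with n hn
    have hn' : (0 : ℝ) < n := Nat.cast_pos.2 hn
    rw [← mul_assoc, ← Real.rpow_add hn', mul_div_right_comm, ← Real.rpow_sub hn',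
      show ((5 : ℕ) : ℝ) + (4 - 3 * τ) - (9 - 3 * τ) = 0 by push_cast; ring, Real.rpow_zero,
      one_mul]
  have hd : (fun n : ℕ => 18 * expect τ hmin n (motifCount diamond)
      / expect τ hmin n (motifCount triangle) ^ 2) =O[atTop] g := by
    simp_rw [expect_diamond hτ hhmin]
    have h1 := ((isTheta_descFactorial 4).1.mul
      (isBigO_patternDensity_diamond hτ hτ' hhmin)).const_mul_left 18
    simp_rw [div_eq_mul_inv]
    refine ((h1.mul (isTheta_inv.2 hsq).1).trans_eventuallyEq ?_).trans hg'
    filter_upwards [eventually_gt_atTop 0] with n hn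
    have hn' : (0 : ℝ) < n := Nat.cast_pos.2 hn
    rw [← Real.rpow_neg hn'.le, ← Real.rpow_add hn', ← Real.rpow_add hn']
    push_cast
    ring_nf
  have ht : (fun n : ℕ => 6 * expect τ hmin n (motifCount triangle)
      / expect τ hmin n (motifCount triangle) ^ 2) =O[atTop] g := by
    simp_rw [div_eq_mul_inv]
    refine ((((isTheta_expect_triangle hτ hτ' hhmin).1.const_mul_left 6).mul
      (isTheta_inv.2 hsq).1).trans ?_).trans hg'
    refine EventuallyEq.trans_isBigO ?_ (isBigO_natCast_rpow (a := (3 * τ - 9) / 2) (by linarith))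
    filter_upwards [eventually_gt_atTop 0] with n hn
    have hn' : (0 : ℝ) < n := Nat.cast_pos.2 hn
    rw [← Real.rpow_neg hn'.le, ← Real.rpow_add hn']
    ring_nf
  have hw : (fun n : ℕ => varianceDefect τ hmin n
      / expect τ hmin n (motifCount triangle) ^ 2) =o[atTop] g := by
    simp_rw [div_eq_mul_inv]
    refine (((isBigO_varianceDefect hτ hτ' hhmin).mul
      (isTheta_inv.2 hsq).1).trans_isLittleO ?_).trans_isBigO hg'
    refine EventuallyEq.trans_isLittleO ?_ (isLittleO_natCast_rpow (a := -1) (by linarith))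
    filter_upwards [eventually_gt_atTop 0] with n hn
    have hn' : (0 : ℝ) < n := Nat.cast_pos.2 hn
    rw [← Real.rpow_neg hn'.le, ← Real.rpow_add hn']
    ring_nf
  have hv : (fun n : ℕ => 9 * expect τ hmin n (motifCount bowTie)
      / expect τ hmin n (motifCount triangle) ^ 2
      + 18 * expect τ hmin n (motifCount diamond)
      / expect τ hmin n (motifCount triangle) ^ 2
      + 6 * expect τ hmin n (motifCount triangle)
      / expect τ hmin n (motifCount triangle) ^ 2) =Θ[atTop] g := by
    -- All three terms are nonnegative, so no cancellation occurs and the sum is at least the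
    -- bow-tie term.
    refine ⟨(hbt.1.add hd).add ht, hbt.2.trans (IsBigO.of_bound 1 (Eventually.of_forall
      fun n => ?_))⟩
    have p1 : 0 ≤ 9 * expect τ hmin n (motifCount bowTie)
      / expect τ hmin n (motifCount triangle) ^ 2 := div_nonneg (mul_nonneg (by norm_num)
        (expect_motifCount_nonneg _ _)) (sq_nonneg _)
    have p2 : 0 ≤ 18 * expect τ hmin n (motifCount diamond)
      / expect τ hmin n (motifCount triangle) ^ 2 := div_nonneg (mul_nonneg (by norm_num)
        (expect_motifCount_nonneg _ _)) (sq_nonneg _)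
    have p3 : 0 ≤ 6 * expect τ hmin n (motifCount triangle)
      / expect τ hmin n (motifCount triangle) ^ 2 := div_nonneg (mul_nonneg (by norm_num)
        (expect_motifCount_nonneg _ _)) (sq_nonneg _)
    rw [one_mul, Real.norm_of_nonneg p1, Real.norm_of_nonneg (add_nonneg (add_nonneg p1 p2) p3)]
    linarith
  refine IsTheta.trans (EventuallyEq.isTheta (EventuallyEq.of_eq (funext fun n => ?_)))
    (hv.add_isLittleO hw.neg_left)
  rw [relFluct_eq, var_motifCount_triangle hτ hhmin, ← varianceDefect]
  simp only [Pi.add_apply]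
  ring

lemma isTheta_relFluct_of_lt (hτ : 2 < τ) (hτ' : τ < 7 / 3) (hhmin : 0 < hmin) :
    (fun n : ℕ => relFluct τ hmin n) =Θ[atTop] fun n : ℕ => (n : ℝ) ^ ((τ - 3) / 2) :=
  isTheta_relFluct hτ (by linarith) hhmin
    (isTheta_integral_kernelTriangle_sq_of_lt hτ hτ' hhmin)
    (isTheta_const_mul_rpow (meanWeight_pos hτ hhmin) _) (isBigO_refl _ _)

lemma isTheta_relFluct_of_eq (hτ : τ = 7 / 3) (hhmin : 0 < hmin) :
    (fun n : ℕ => relFluct τ hmin n) =Θ[atTop]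
      fun n : ℕ => (n : ℝ) ^ (2 * τ - 5) * Real.log n := by
  have hm := meanWeight_pos (τ := τ) (by linarith) hhmin
  refine isTheta_relFluct (by linarith) (by linarith) hhmin
    (isTheta_integral_kernelTriangle_sq_of_eq hτ hhmin)
    ((isTheta_const_mul_rpow hm _).mul (isTheta_log_const_mul hm))
    ((isBigO_natCast_rpow (b := 2 * τ - 5) (by linarith)).trans
      ((isBigO_log_mul (f := fun x => x ^ (2 * τ - 5))).comp_tendsto tendsto_natCast_atTop_atTop))

lemma isTheta_relFluct_of_gt (hτ : 7 / 3 < τ) (hτ' : τ < 3) (hhmin : 0 < hmin) :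
    (fun n : ℕ => relFluct τ hmin n) =Θ[atTop] fun n : ℕ => (n : ℝ) ^ (2 * τ - 5) :=
  isTheta_relFluct (by linarith) hτ' hhmin
    (isTheta_integral_kernelTriangle_sq_of_gt hτ hτ' hhmin)
    (isTheta_const_mul_rpow (meanWeight_pos (by linarith) hhmin) _)
    (isBigO_natCast_rpow (by linarith))

lemma relFluct_nonneg (τ hmin : ℝ) (n : ℕ) : 0 ≤ relFluct τ hmin n :=
  div_nonneg (variance_nonneg _ _) (sq_nonneg _)

lemma tendsto_natCast_rpow_zero {a : ℝ} (ha : a < 0) :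
    Tendsto (fun n : ℕ => (n : ℝ) ^ a) atTop (𝓝 0) := by
  have := (tendsto_rpow_neg_atTop (neg_pos.2 ha)).comp (tendsto_natCast_atTop_atTop (R := ℝ))
  simpa [Function.comp_def] using this

lemma tendsto_relFluct_zero (hτ : 2 < τ) (hτ' : τ < 5 / 2) (hhmin : 0 < hmin) :
    Tendsto (fun n : ℕ => relFluct τ hmin n) atTop (𝓝 0) := by
  obtain h | h | h := lt_trichotomy τ (7 / 3)
  · exact (isTheta_relFluct_of_lt hτ h hhmin).1.trans_tendsto
      (tendsto_natCast_rpow_zero (by linarith))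
  · refine (isTheta_relFluct_of_eq h hhmin).1.trans_tendsto ?_
    -- At τ = 7/3 the exponent 2τ-5 is -1/3, and the logarithm is negligible against the positive
    -- power.
    have h1 : (fun x : ℝ => x ^ (2 * τ - 5) * Real.log x) =ᶠ[atTop]
        fun x => Real.log x / x ^ (5 - 2 * τ) := by
      filter_upwards [eventually_gt_atTop 0] with x hx
      rw [show 2 * τ - 5 = -(5 - 2 * τ) by ring, Real.rpow_neg hx.le, div_eq_mul_inv, mul_comm]
    have h2 := ((isLittleO_log_rpow_atTop (show 0 < 5 - 2 * τ by linarith)).tendsto_div_nhds_zero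
      ).congr' h1.symm
    exact h2.comp tendsto_natCast_atTop_atTop
  · exact (isTheta_relFluct_of_gt h (by linarith) hhmin).1.trans_tendsto
      (tendsto_natCast_rpow_zero (by linarith))

lemma isTheta_relFluct_one (hτ : τ = 5 / 2) (hhmin : 0 < hmin) :
    (fun n : ℕ => relFluct τ hmin n) =Θ[atTop] fun _ : ℕ => (1 : ℝ) := by
  have h := isTheta_relFluct_of_gt (τ := τ) (by linarith) (by linarith) hhmin
  simpa [show 2 * τ - 5 = 0 by linarith] using h

/-- The order only controls the norm; nonnegativity of the ratio turns divergence of the norm into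
divergence to +∞. -/
lemma tendsto_relFluct_atTop (hτ : 5 / 2 < τ) (hτ' : τ < 3) (hhmin : 0 < hmin) :
    Tendsto (fun n : ℕ => relFluct τ hmin n) atTop atTop := by
  have h := (isTheta_relFluct_of_gt (τ := τ) (by linarith) hτ' hhmin).tendsto_norm_atTop_iff
  have h1 : Tendsto (fun n : ℕ => (n : ℝ) ^ (2 * τ - 5)) atTop atTop :=
    (tendsto_rpow_atTop (by linarith)).comp tendsto_natCast_atTop_atTop
  have h2 := h.2 (tendsto_norm_atTop_atTop.comp h1)
  refine h2.congr fun n => ?_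
  exact Real.norm_of_nonneg (relFluct_nonneg τ hmin n)

lemma tendsto_relFluct_zero_iff (hτ : 2 < τ) (hτ' : τ < 3) (hhmin : 0 < hmin) :
    Tendsto (fun n : ℕ => relFluct τ hmin n) atTop (𝓝 0) ↔ τ < 5 / 2 := by
  refine ⟨fun h => ?_, fun h => tendsto_relFluct_zero hτ h hhmin⟩
  by_contra! hge
  obtain h1 | h1 := hge.eq_or_lt
  · have := (isTheta_relFluct_one h1.symm hhmin).tendsto_zero_iff.1 h
    exact one_ne_zero (tendsto_nhds_unique tendsto_const_nhds this)
  · exact not_tendsto_nhds_of_tendsto_atTop (tendsto_relFluct_atTop h1 hτ' hhmin) 0 h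

end Sequences

end HiddenVariable

theorem mainTheorem7 (τ hmin : ℝ) (hτ : 2 < τ) (hτ' : τ < 3) (hhmin : 0 < hmin) :
    -- labelled triangles are counted six times
    (∀ (n : ℕ) (G : SimpleGraph (Fin n)),
      HiddenVariable.motifCount HiddenVariable.triangle G
        = 6 * HiddenVariable.triangleCount G) ∧
    -- the variance identity for labelled counts
    ((fun n : ℕ =>
        HiddenVariable.var τ hmin n (HiddenVariable.motifCount HiddenVariable.triangle)
          - (9 * HiddenVariable.expect τ hmin n
                (HiddenVariable.motifCount HiddenVariable.bowTie)
              + 18 * HiddenVariable.expect τ hmin n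
                (HiddenVariable.motifCount HiddenVariable.diamond)
              + 6 * HiddenVariable.expect τ hmin n
                (HiddenVariable.motifCount HiddenVariable.triangle)))
      =O[atTop] fun n : ℕ =>
        (n : ℝ)⁻¹ * HiddenVariable.expect τ hmin n
          (HiddenVariable.motifCount HiddenVariable.triangle) ^ 2) ∧
    -- the order of the relative fluctuation
    (τ < 7 / 3 →
      (fun n : ℕ => HiddenVariable.relFluct τ hmin n)
        =Θ[atTop] fun n : ℕ => (n : ℝ) ^ ((τ - 3) / 2)) ∧
    (τ = 7 / 3 →
      (fun n : ℕ => HiddenVariable.relFluct τ hmin n)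
        =Θ[atTop] fun n : ℕ => (n : ℝ) ^ (2 * τ - 5) * Real.log n) ∧
    (7 / 3 < τ →
      (fun n : ℕ => HiddenVariable.relFluct τ hmin n)
        =Θ[atTop] fun n : ℕ => (n : ℝ) ^ (2 * τ - 5)) ∧
    -- the limits, and the classification
    (τ < 5 / 2 → Tendsto (fun n : ℕ => HiddenVariable.relFluct τ hmin n) atTop (𝓝 0)) ∧
    (τ = 5 / 2 → (fun n : ℕ => HiddenVariable.relFluct τ hmin n) =Θ[atTop] fun _ : ℕ => (1 : ℝ)) ∧
    (5 / 2 < τ → Tendsto (fun n : ℕ => HiddenVariable.relFluct τ hmin n) atTop atTop) ∧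
    (Tendsto (fun n : ℕ => HiddenVariable.relFluct τ hmin n) atTop (𝓝 0) ↔ τ < 5 / 2) := by
  open HiddenVariable in
  exact ⟨fun _ G => motifCount_triangle G, isBigO_var_sub hτ hτ' hhmin,
    fun h => isTheta_relFluct_of_lt hτ h hhmin, fun h => isTheta_relFluct_of_eq h hhmin,
    fun h => isTheta_relFluct_of_gt h hτ' hhmin, fun h => tendsto_relFluct_zero hτ h hhmin,
    fun h => isTheta_relFluct_one h hhmin, fun h => tendsto_relFluct_atTop h hτ' hhmin,
    tendsto_relFluct_zero_iff hτ hτ' hhmin⟩
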